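/- **Notation.** For $k\in\mathbb N=\{1,2,\dots\}$ and $x\in\mathbb Q$ let $\sigma_k(x)=\sum_{d\mid x,\,d\ge1}d^k$ if $x$ is a positive integer and $\sigma_k(x)=0$ otherwise, and write $\sigma=\sigma_1$. For $r,s\in\mathbb N$ let $$W_{r,s}(n)=\sum_{\substack{(l,m)\in\mathbb Z_{\ge0}^2\\ rl+sm=n}}\sigma(l)\sigma(m).$$ For $\operatorname{Im} z>0$ let $q=e^{2\pi iz}$ and let $\eta(z)=e^{\pi iz/12}\prod_{n\ge1}(1-e^{2\pi inz})$ be the Dedekind eta function. Define the eta quotients $$C_{1}=\frac{\eta^{5}(z)\eta^{5}(7z)}{\eta(2z)\eta(14z)},$$ $$C_{2}=\eta^{2}(z)\eta^{2}(2z)\eta^{2}(7z)\eta^{2}(14z),$$ $$C_{3}=\frac{\eta^{6}(z)\eta^{6}(14z)}{\eta^{2}(2z)\eta^{2}(7z)},$$ $$C_{4}=\frac{\eta^{6}(2z)\eta^{6}(7z)}{\eta^{2}(z)\eta^{2}(14z)},$$ $$C_{5}=\eta^{2}(z)\eta^{2}(2z)\eta^{2}(3z)\eta^{2}(6z),$$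 $$C_{6}=\eta(2z)\eta^{3}(3z)\eta(7z)\eta^{3}(42z),$$ $$C_{7}=\eta(z)\eta^{3}(6z)\eta(14z)\eta^{3}(21z),$$ $$C_{8}=\eta^{2}(7z)\eta^{2}(14z)\eta^{2}(21z)\eta^{2}(42z),$$ $$C_{9}=\eta(3z)\eta(6z)\eta^{3}(7z)\eta^{3}(14z),$$ $$C_{10}=\eta^{2}(2z)\eta^{2}(6z)\eta^{2}(7z)\eta^{2}(21z),$$ $$C_{11}=\eta(z)\eta(2z)\eta^{3}(21z)\eta^{3}(42z),$$ $$C_{12}=\eta^{3}(z)\eta(6z)\eta^{3}(14z)\eta(21z),$$ $$C_{13}=\eta^{3}(z)\eta^{3}(2z)\eta(21z)\eta(42z),$$ $$C_{14}=\frac{\eta^{2}(2z)\eta^{2}(14z)\eta^{6}(21z)}{\eta^{2}(7z)},$$ $$C_{15}=\frac{\eta^{6}(2z)\eta^{2}(3z)\eta^{2}(21z)}{\eta^{2}(6z)},$$ $$C_{16}=\frac{\eta^{5}(2z)\eta^{5}(21z)}{\eta(z)\eta(42z)},$$ $$C_{17}=\frac{\eta^{6}(6z)\eta^{6}(21z)}{\eta^{2}(3z)\eta^{2}(42z)},$$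 $$C_{18}=\frac{\eta^{3}(6z)\eta(7z)\eta(14z)\eta^{4}(21z)}{\eta(3z)},$$ $$C_{19}=\eta^{2}(3z)\eta^{2}(6z)\eta^{2}(21z)\eta^{2}(42z),$$ $$C_{20}=\frac{\eta^{4}(3z)\eta^{4}(14z)\eta^{2}(21z)\eta^{2}(42z)}{\eta^{2}(6z)\eta^{2}(7z)}.$$ Each of them has an expansion $C_k=\sum_{n\ge1}c_k(n)q^n$, valid for all $z$ in the upper half-plane, with integer coefficients; this defines the integers $c_k(n)$, $1\le k\le20$, $n\ge1$. **Theorem.** For every positive integer $n$, with $$A(n)=\tfrac{1}{6000}\sigma_3(n) + \tfrac{1}{1500}\sigma_3(n/2) + \tfrac{3}{2000}\sigma_3(n/3) + \tfrac{3}{500}\sigma_3(n/6) + \tfrac{49}{6000}\sigma_3(n/7) + \tfrac{49}{1500}\sigma_3(n/14) + \tfrac{147}{2000}\sigma_3(n/21) + \tfrac{147}{500}\sigma_3(n/42),$$ one has $$W_{1,42}(n) = A(n) + \left(\tfrac1{24}-\tfrac{n}{168}\right)\sigma(n) + \left(\tfrac1{24}-\tfrac{n}{4}\right)\sigma(n/42)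 -\tfrac{1}{35}c_{1}(n) -\tfrac{57}{2800}c_{2}(n) -\tfrac{1}{140}c_{4}(n) -\tfrac{1}{6000}c_{5}(n) +\tfrac{49}{40}c_{6}(n) -\tfrac{883}{200}c_{7}(n) +\tfrac{2051}{6000}c_{8}(n) +\tfrac{17}{120}c_{9}(n) -\tfrac{97}{50}c_{10}(n) +\tfrac{543}{40}c_{11}(n) -\tfrac{127}{150}c_{12}(n) +\tfrac{31}{60}c_{13}(n) -\tfrac{27}{10}c_{14}(n) -\tfrac{1}{5}c_{15}(n) +\tfrac{43}{20}c_{16}(n) -\tfrac{9}{10}c_{18}(n) -\tfrac{9}{400}c_{19}(n) -\tfrac{3}{20}c_{20}(n)$$ $$W_{2,21}(n) = A(n) + \left(\tfrac1{24}-\tfrac{n}{84}\right)\sigma(n/2) + \left(\tfrac1{24}-\tfrac{n}{8}\right)\sigma(n/21) -\tfrac{1}{70}c_{1}(n) -\tfrac{57}{2800}c_{2}(n) -\tfrac{1}{28}c_{3}(n) +\tfrac{1}{70}c_{4}(n) -\tfrac{1}{6000}c_{5}(n) +\tfrac{13}{8}c_{6}(n) -\tfrac{703}{200}c_{7}(n)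 -\tfrac{4249}{6000}c_{8}(n) +\tfrac{41}{120}c_{9}(n) -\tfrac{97}{50}c_{10}(n) +\tfrac{379}{40}c_{11}(n) -\tfrac{61}{75}c_{12}(n) +\tfrac{11}{20}c_{13}(n) -\tfrac{18}{5}c_{14}(n) -\tfrac{1}{10}c_{15}(n) +\tfrac{39}{20}c_{16}(n) +\tfrac{3}{10}c_{18}(n) -\tfrac{9}{400}c_{19}(n) -\tfrac{9}{20}c_{20}(n)$$ $$W_{3,14}(n) = A(n) + \left(\tfrac1{24}-\tfrac{n}{56}\right)\sigma(n/3) + \left(\tfrac1{24}-\tfrac{n}{12}\right)\sigma(n/14) +\tfrac{1}{35}c_{1}(n) -\tfrac{1}{400}c_{2}(n) -\tfrac{1}{35}c_{4}(n) -\tfrac{1}{6000}c_{5}(n) -\tfrac{37}{40}c_{6}(n) +\tfrac{837}{200}c_{7}(n) -\tfrac{2149}{6000}c_{8}(n) -\tfrac{17}{120}c_{9}(n) +\tfrac{103}{50}c_{10}(n) -\tfrac{543}{40}c_{11}(n) +\tfrac{87}{100}c_{12}(n) -\tfrac{31}{60}c_{13}(n) +\tfrac{27}{10}c_{14}(n)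 +\tfrac{1}{5}c_{15}(n) -\tfrac{43}{20}c_{16}(n) -\tfrac{9}{28}c_{17}(n) +\tfrac{9}{10}c_{18}(n) -\tfrac{513}{2800}c_{19}(n) +\tfrac{3}{20}c_{20}(n)$$ $$W_{6,7}(n) = A(n) + \left(\tfrac1{24}-\tfrac{n}{28}\right)\sigma(n/6) + \left(\tfrac1{24}-\tfrac{n}{24}\right)\sigma(n/7) +\tfrac{1}{70}c_{1}(n) -\tfrac{407}{2800}c_{2}(n) +\tfrac{1}{28}c_{3}(n) +\tfrac{3}{140}c_{4}(n) -\tfrac{1507}{42000}c_{5}(n) -\tfrac{53}{40}c_{6}(n) +\tfrac{6899}{1400}c_{7}(n) -\tfrac{6349}{6000}c_{8}(n) -\tfrac{41}{120}c_{9}(n) +\tfrac{221}{350}c_{10}(n) -\tfrac{379}{40}c_{11}(n) +\tfrac{969}{700}c_{12}(n) -\tfrac{11}{20}c_{13}(n) +\tfrac{18}{5}c_{14}(n) +\tfrac{1}{10}c_{15}(n) -\tfrac{39}{20}c_{16}(n) +\tfrac{9}{28}c_{17}(n) -\tfrac{3}{10}c_{18}(n) -\tfrac{4113}{2800}c_{19}(n)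 +\tfrac{9}{20}c_{20}(n)$$ -/

import Mathlib

open scoped ModularForm UpperHalfPlane

/-- `σ_k` on rational arguments: the sum of the `k`-th powers of the positive divisors of `x` if `x`
is a positive integer, and `0` for every other rational number `x` (in particular `σ_k(0) = 0`). -/
def sigmaRat (k : ℕ) (x : ℚ) : ℕ :=
  if x.den = 1 then ArithmeticFunction.sigma k x.num.toNat else 0

/-- The convolution sum `W_{r,s}(n)`, the sum of `σ(l) σ(m)` over all pairs `(l, m)` of nonnegative
integers with `r l + s m = n`. For `r, s ≥ 1` such pairs have `l, m ≤ n`, so that the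
finite index set below contains all of them. -/
def convSum (r s n : ℕ) : ℕ :=
  ∑ p ∈ (Finset.range (n + 1) ×ˢ Finset.range (n + 1)).filter (fun p => r * p.1 + s * p.2 = n),
    sigmaRat 1 p.1 * sigmaRat 1 p.2

/-- The twenty eta quotients `C_1, …, C_20` at the point `z`, in terms of Mathlib's Dedekind eta
function (the value for other indices is irrelevant). -/
noncomputable def etaC (k : ℕ) (z : ℂ) : ℂ :=
  match k with
  | 1 => (η z ^ 5 * η (7 * z) ^ 5) / (η (2 * z) * η (14 * z))
  | 2 => η z ^ 2 * η (2 * z) ^ 2 * η (7 * z) ^ 2 * η (14 * z) ^ 2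
  | 3 => (η z ^ 6 * η (14 * z) ^ 6) / (η (2 * z) ^ 2 * η (7 * z) ^ 2)
  | 4 => (η (2 * z) ^ 6 * η (7 * z) ^ 6) / (η z ^ 2 * η (14 * z) ^ 2)
  | 5 => η z ^ 2 * η (2 * z) ^ 2 * η (3 * z) ^ 2 * η (6 * z) ^ 2
  | 6 => η (2 * z) * η (3 * z) ^ 3 * η (7 * z) * η (42 * z) ^ 3
  | 7 => η z * η (6 * z) ^ 3 * η (14 * z) * η (21 * z) ^ 3
  | 8 => η (7 * z) ^ 2 * η (14 * z) ^ 2 * η (21 * z) ^ 2 * η (42 * z) ^ 2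
  | 9 => η (3 * z) * η (6 * z) * η (7 * z) ^ 3 * η (14 * z) ^ 3
  | 10 => η (2 * z) ^ 2 * η (6 * z) ^ 2 * η (7 * z) ^ 2 * η (21 * z) ^ 2
  | 11 => η z * η (2 * z) * η (21 * z) ^ 3 * η (42 * z) ^ 3
  | 12 => η z ^ 3 * η (6 * z) * η (14 * z) ^ 3 * η (21 * z)
  | 13 => η z ^ 3 * η (2 * z) ^ 3 * η (21 * z) * η (42 * z)
  | 14 => (η (2 * z) ^ 2 * η (14 * z) ^ 2 * η (21 * z) ^ 6) / η (7 * z) ^ 2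
  | 15 => (η (2 * z) ^ 6 * η (3 * z) ^ 2 * η (21 * z) ^ 2) / η (6 * z) ^ 2
  | 16 => (η (2 * z) ^ 5 * η (21 * z) ^ 5) / (η z * η (42 * z))
  | 17 => (η (6 * z) ^ 6 * η (21 * z) ^ 6) / (η (3 * z) ^ 2 * η (42 * z) ^ 2)
  | 18 => (η (6 * z) ^ 3 * η (7 * z) * η (14 * z) * η (21 * z) ^ 4) / (η (3 * z))
  | 19 => η (3 * z) ^ 2 * η (6 * z) ^ 2 * η (21 * z) ^ 2 * η (42 * z) ^ 2
  | 20 => (η (3 * z) ^ 4 * η (14 * z) ^ 4 * η (21 * z) ^ 2 * η (42 * z) ^ 2) / (η (6 * z) ^ 2 * η (7 * z) ^ 2)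
  | _ => 0

/-- The Fourier coefficient `c_k(n)`: the coefficient of `q ^ n`, `q = exp (2 π i z)`, in the
`q`-expansion of `C_k` as a function on the upper half-plane. -/
noncomputable def etaCoeff (k n : ℕ) : ℂ :=
  (UpperHalfPlane.qExpansion 1 (fun z : ℍ => etaC k z)).coeff n

/-! For rs = 42 let F = r E₂(rz) − s E₂(sz). Neither term is modular, but under a matrix γ the
defect of r E₂(rz) does not depend on r (`E2_scale_slash`), so F has weight 2 and F² is a modular
form of weight 4 on Γ₀(42). In F² the cross term −2rs E₂(rz)E₂(sz) carries the convolution sum, and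
Ramanujan's identity E₂² = E₄ + 12 q dE₂/dq (`eisSeries₂_sq`) turns the two squares into σ₃(n/·) and
nσ(n/·). A formula for the convolution sum is therefore the same as an expression of F² through the
E₄(δz), δ ∣ 42, and the eta quotients.

Such an expression is a finite check. Since Γ₀(42) has index at most 96, a form of weight 4 whose
first 33 coefficients vanish is zero (`IsModularOn.eq_zero`): its norm to level one has weight at
most 384 and vanishes to order 33 > 384/12. The coefficients are computed in integer list
arithmetic, starting from Euler's pentagonal series (`eisDiffSeries_sq_eq`).

The remaining work is the modularity of the eta quotients. An explicit multiplier for η, valid for a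
nonnegative bottom row, is propagated by Euclidean descent (`eta_mobius`); in the quotients its
Jacobi symbols and 24th roots of unity cancel (`IsEtaQuotOfLevel.etaProd_mobius`). Boundedness at
the cusps needs no multiplier, only η²⁴ = Δ and the factorization of (r 0; 0 1)γ as unimodular times
upper triangular (`IsEtaQuotOfLevel.isBounded`). -/

section

open scoped ModularForm UpperHalfPlane
open Function UpperHalfPlane Filter Topology Manifold
open EisensteinSeries Derivative
open scoped MatrixGroups ArithmeticFunction.sigma NumberTheorySymbols

/-! ### Calculus of q-expansions on the upper half-plane -/

/-- `HasQExp f p` means that `f τ = ∑ pₙ qⁿ` with `q = exp (2 π i τ)` on the whole upper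
half-plane. -/
def HasQExp (f : ℍ → ℂ) (p : PowerSeries ℂ) : Prop :=
  ∀ τ : ℍ, HasSum (fun n : ℕ => p.coeff n * Periodic.qParam 1 τ ^ n) (f τ)

namespace HasQExp

variable {f g : ℍ → ℂ} {p r : PowerSeries ℂ}

theorem add (hf : HasQExp f p) (hg : HasQExp g r) : HasQExp (f + g) (p + r) := fun τ => by
  simpa [add_mul] using (hf τ).add (hg τ)

theorem smul (a : ℂ) (hf : HasQExp f p) : HasQExp (a • f) (a • p) := fun τ => by
  simpa [mul_assoc] using (hf τ).mul_left a

theorem sub (hf : HasQExp f p) (hg : HasQExp g r) : HasQExp (f - g) (p - r) := fun τ => by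
  simpa [sub_mul] using (hf τ).sub (hg τ)

theorem sum {ι : Type*} {s : Finset ι} {f : ι → ℍ → ℂ} {p : ι → PowerSeries ℂ}
    (h : ∀ i ∈ s, HasQExp (f i) (p i)) : HasQExp (∑ i ∈ s, f i) (∑ i ∈ s, p i) := fun τ => by
  simpa [Finset.sum_mul] using hasSum_sum fun i hi => h i hi τ

theorem mul (hf : HasQExp f p) (hg : HasQExp g r) : HasQExp (f * g) (p * r) := fun τ => by
  have h1 := (hf τ).summable.norm
  have h2 := (hg τ).summable.norm
  have h := (summable_norm_sum_mul_antidiagonal_of_summable_norm h1 h2).of_norm.hasSum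
  rw [← tsum_mul_tsum_eq_tsum_sum_antidiagonal_of_summable_norm h1 h2, (hf τ).tsum_eq,
    (hg τ).tsum_eq] at h
  convert! h using 2 with n
  rw [PowerSeries.coeff_mul, Finset.sum_mul]
  refine Finset.sum_congr rfl fun ij hij => ?_
  rw [← Finset.HasAntidiagonal.mem_antidiagonal.mp hij, pow_add]
  ring

theorem one : HasQExp 1 1 := fun τ => by
  have := hasSum_single (f := fun n : ℕ => (1 : PowerSeries ℂ).coeff n *
    Periodic.qParam 1 (τ : ℂ) ^ n) 0 (fun n hn => by simp [PowerSeries.coeff_one, hn])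
  simpa using this

theorem qParam : HasQExp (fun τ => Periodic.qParam 1 τ) PowerSeries.X := fun τ => by
  have := hasSum_single (f := fun n : ℕ => (PowerSeries.X : PowerSeries ℂ).coeff n *
    Periodic.qParam 1 (τ : ℂ) ^ n) 1 (fun n hn => by simp [PowerSeries.coeff_X, hn])
  simpa using this

theorem pow (hf : HasQExp f p) (n : ℕ) : HasQExp (f ^ n) (p ^ n) := by
  induction n with
  | zero => simpa using one
  | succ n ih => simpa [pow_succ] using ih.mul hf

theorem prod {ι : Type*} {s : Finset ι} {f : ι → ℍ → ℂ} {p : ι → PowerSeries ℂ}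
    (h : ∀ i ∈ s, HasQExp (f i) (p i)) : HasQExp (∏ i ∈ s, f i) (∏ i ∈ s, p i) := by
  classical
  induction s using Finset.induction_on with
  | empty => simpa using one
  | insert i s hi ih =>
    rw [Finset.prod_insert hi, Finset.prod_insert hi]
    exact (h i (by simp)).mul (ih fun j hj => h j (by simp [hj]))

theorem isBoundedAtImInfty (hf : HasQExp f p) : IsBoundedAtImInfty f :=
  isBoundedAtImInfty_of_hasSum_qExpansion one_pos (c := fun n => p.coeff n) fun τ => by
    simpa using hf τ

theorem periodic (hf : HasQExp f p) : Periodic (f ∘ ofComplex) ((1 : ℝ) : ℂ) := fun w => by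
  by_cases hw : 0 < w.im
  · have hw' : 0 < (w + ((1 : ℝ) : ℂ)).im := by simpa using hw
    simp only [comp_apply, ofComplex_apply_of_im_pos hw, ofComplex_apply_of_im_pos hw']
    refine (hf _).unique ?_
    convert hf ⟨w, hw⟩ using 3 with n
    congr 1
    simp [Periodic.qParam, mul_add, Complex.exp_add]
  -- Outside the upper half-plane `ofComplex` takes a single default value, so periodicity holds
  -- there trivially.
  · have hw' : ¬ 0 < (w + ((1 : ℝ) : ℂ)).im := by simpa using hw
    rw [comp_apply, comp_apply, ofComplex_apply_of_im_nonpos (not_lt.mp hw),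
      ofComplex_apply_of_im_nonpos (not_lt.mp hw')]

theorem analyticAt (hf : HasQExp f p) (hd : MDiff f) : AnalyticAt ℂ (cuspFunction 1 f) 0 :=
  analyticAt_cuspFunction_zero one_pos hf.periodic hd hf.isBoundedAtImInfty

/-- The given series is a power series of the cusp function on the unit disc, and a Taylor expansion
at 0 is unique. This is the bridge from explicit series to `qExpansion`. -/
theorem qExpansion_eq (hf : HasQExp f p) (hd : MDiff f) : qExpansion 1 f = p := by
  ext n
  have h : ∀ τ : ℍ, HasSum (fun m => (fun n => p.coeff n) m • Periodic.qParam 1 τ ^ m) (f τ) :=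
    fun τ => by simpa using hf τ
  have h1 := (hasFPowerSeriesOnBall_cuspFunction one_pos (hf.analyticAt hd) h).hasFPowerSeriesAt
  have h2 := (hf.analyticAt hd).hasFPowerSeriesAt
  have h3 := congr_arg (FormalMultilinearSeries.coeff · n) (h1.eq_formalMultilinearSeries h2)
  simp only [FormalMultilinearSeries.coeff_ofScalars] at h3
  rw [qExpansion_coeff, h3, div_eq_mul_inv, mul_comm]

theorem unique (hf : HasQExp f p) (hr : HasQExp f r) (hd : MDiff f) : p = r :=
  (hf.qExpansion_eq hd).symm.trans (hr.qExpansion_eq hd)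

theorem of_qExpansion (hper : Periodic (f ∘ ofComplex) ((1 : ℝ) : ℂ)) (hd : MDiff f)
    (hb : IsBoundedAtImInfty f) : HasQExp f (qExpansion 1 f) := fun τ => by
  simpa using hasSum_qExpansion one_pos hper hd hb τ

end HasQExp

/-- Multiplication by a positive integer on the upper half-plane. -/
noncomputable def scaleH (d : ℕ) [NeZero d] (τ : ℍ) : ℍ :=
  ⟨d * τ, by simpa using mul_pos (Nat.cast_pos.mpr (NeZero.pos d)) τ.im_pos⟩

@[simp] theorem coe_scaleH (d : ℕ) [NeZero d] (τ : ℍ) : (scaleH d τ : ℂ) = d * τ := rfl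

theorem mdiff_comp_scaleH {f : ℍ → ℂ} (hf : MDiff f) (d : ℕ) [NeZero d] :
    MDiff (fun τ => f (scaleH d τ)) := by
  rw [UpperHalfPlane.mdifferentiable_iff] at hf ⊢
  have h1 : DifferentiableOn ℂ (fun z : ℂ => (d : ℂ) * z) {z : ℂ | 0 < z.im} := by fun_prop
  have hm : Set.MapsTo (fun z : ℂ => (d : ℂ) * z) {z : ℂ | 0 < z.im} {z : ℂ | 0 < z.im} :=
    fun z hz => by simpa using mul_pos (Nat.cast_pos.mpr (NeZero.pos d)) hz
  refine (hf.comp h1 hm).congr fun z hz => ?_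
  simp only [comp_apply, ofComplex_apply_of_im_pos hz, ofComplex_apply_of_im_pos (hm hz)]
  rfl

theorem HasQExp.scale {f : ℍ → ℂ} {p : PowerSeries ℂ} (hf : HasQExp f p) (d : ℕ) [NeZero d] :
    HasQExp (fun τ => f (scaleH d τ)) (p.expand d (NeZero.ne d)) := fun τ => by
  have h := hf (scaleH d τ)
  have hq : Periodic.qParam 1 (scaleH d τ : ℂ) = Periodic.qParam 1 τ ^ d := by
    simp only [Periodic.qParam, coe_scaleH, ← Complex.exp_nat_mul]
    congr 1; ring
  have hinj : Injective (fun n : ℕ => d * n) := fun a b h => by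
    simpa [NeZero.ne d] using h
  rw [← hinj.hasSum_iff]
  · convert h using 2 with n
    rw [hq, ← pow_mul]; simp
  · intro n hn
    rw [PowerSeries.coeff_expand_of_not_dvd _ _ _ (fun ⟨k, hk⟩ => hn ⟨k, hk.symm⟩), zero_mul]

/-! ### Euler's product and the pentagonal number theorem -/

theorem norm_prod_one_sub_pow_le {x : ℂ} (hx : ‖x‖ < 1) (k n : ℕ) :
    ‖∏ i ∈ Finset.range n, (1 - x ^ (k + i + 1))‖ ≤ Real.exp (1 - ‖x‖)⁻¹ := by
  have hs := summable_geometric_of_lt_one (norm_nonneg x) hx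
  calc ‖∏ i ∈ Finset.range n, (1 - x ^ (k + i + 1))‖
      ≤ ∏ i ∈ Finset.range n, Real.exp (‖x‖ ^ i) := by
        rw [norm_prod]
        refine Finset.prod_le_prod (fun _ _ => norm_nonneg _) fun i _ => ?_
        calc ‖1 - x ^ (k + i + 1)‖ ≤ ‖x‖ ^ (k + i + 1) + 1 := by
              simpa [add_comm 1 (‖x‖ ^ _)] using norm_sub_le (1 : ℂ) (x ^ (k + i + 1))
          _ ≤ ‖x‖ ^ i + 1 := by
              gcongr ?_ + 1
              exact pow_le_pow_of_le_one (norm_nonneg x) hx.le (by omega)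
          _ ≤ _ := Real.add_one_le_exp _
    _ = Real.exp (∑ i ∈ Finset.range n, ‖x‖ ^ i) := (Real.exp_sum _ _).symm
    _ ≤ _ := by
        rw [← tsum_geometric_of_lt_one (norm_nonneg x) hx]
        exact Real.exp_le_exp.mpr (hs.sum_le_tsum _ fun _ _ => by positivity)

theorem norm_coeff_pentagonalSeries_le (n : ℕ) :
    ‖(PowerSeries.pentagonalSeries ℂ).coeff n‖ ≤ 1 := by
  rw [PowerSeries.pentagonalSeries, PowerSeries.coeff_mk]
  split_ifs with h
  · rcases Int.units_eq_one_or (Int.negOnePow h.choose) with h | h <;> simp [h]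
  · simp

/-- Euler's pentagonal number theorem on the open unit disc. -/
theorem hasSum_pentagonalSeries_tprod {x : ℂ} (hx : ‖x‖ < 1) :
    HasSum (fun n => (PowerSeries.pentagonalSeries ℂ).coeff n * x ^ n)
      (∏' n : ℕ, (1 - x ^ (n + 1))) := by
  have hgeo := summable_geometric_of_lt_one (norm_nonneg x) hx
  have hs : Summable fun n => (PowerSeries.pentagonalSeries ℂ).coeff n * x ^ n := by
    refine hgeo.of_norm_bounded fun n => ?_
    rw [norm_mul, norm_pow]
    exact mul_le_of_le_one_left (by positivity) (norm_coeff_pentagonalSeries_le n)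
  have hZ := hs.hasSum
  -- The series is supported on the pentagonal numbers. It is reindexed over ℤ, reflected, and then
  -- k is paired with −k − 1, which is the shape of the limit in the pentagonal identity.
  rw [← pentagonal_injective.hasSum_iff
    (fun n hn => by rw [PowerSeries.coeff_pentagonalSeries_eq_zero ℂ hn, zero_mul])] at hZ
  rw [← neg_injective.hasSum_iff (fun x hx => by absurd hx; use -x; simp)] at hZ
  have hN := hZ.nat_add_neg_add_one
  have hN' : HasSum (fun k : ℕ => (-1) ^ k * (x ^ pentagonal (-k) - x ^ pentagonal (k + 1)))
      (∑' n, (PowerSeries.pentagonalSeries ℂ).coeff n * x ^ n) := by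
    convert hN using 2 with k
    simp_rw [Function.comp_apply, neg_neg, PowerSeries.coeff_pentagonalSeries_pentagonal,
      Int.negOnePow_add]
    simp [Int.negOnePow_def]
    ring
  have hb (k n : ℕ) : ‖x ^ ((k + 1) * n) * ∏ i ∈ Finset.range (n + 1), (1 - x ^ (k + i + 1))‖ ≤
      ‖x‖ ^ n * Real.exp (1 - ‖x‖)⁻¹ := by
    rw [norm_mul, norm_pow]
    refine mul_le_mul ?_ (norm_prod_one_sub_pow_le hx k _) (norm_nonneg _) (by positivity)
    exact pow_le_pow_of_le_one (norm_nonneg x) hx.le (Nat.le_mul_of_pos_left n (by omega))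
  have hsumk (k : ℕ) : Summable
      (fun n ↦ x ^ ((k + 1) * n) * ∏ i ∈ Finset.range (n + 1), (1 - x ^ (k + i + 1))) :=
    (hgeo.mul_right _).of_norm_bounded (hb k)
  -- The formal identity becomes analytic once its remainder tends to 0; the uniform bound `hb`
  -- leaves a factor ‖x‖ᵏ times a constant.
  have key := Pentagonal.tprod_one_sub_pow (x := x) (tendsto_pow_atTop_nhds_zero_of_norm_lt_one hx)
    hsumk (fun k => by
      have := (ModularForm.multipliable_one_sub_pow hx)
      simp_rw [sub_eq_add_neg]
      refine multipliable_one_add_of_summable ?_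
      simp_rw [norm_neg, norm_pow]
      exact (summable_nat_add_iff (k + 1)).mpr hgeo) hN'.summable (by
      refine squeeze_zero_norm (a := fun k => ‖x‖ ^ k *
        ∑' n, ‖x‖ ^ n * Real.exp (1 - ‖x‖)⁻¹) (fun k => ?_) ?_
      · rw [norm_mul, norm_mul, norm_pow, norm_pow, norm_neg, norm_one, one_pow, one_mul]
        refine mul_le_mul ?_ (tsum_of_norm_bounded (hgeo.mul_right _).hasSum (hb k))
          (norm_nonneg _) (by positivity)
        refine pow_le_pow_of_le_one (norm_nonneg x) hx.le ?_
        rw [Nat.le_div_iff_mul_le two_pos]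
        nlinarith
      · simpa using (tendsto_pow_atTop_nhds_zero_of_lt_one (norm_nonneg x) hx).mul_const
          (∑' n, ‖x‖ ^ n * Real.exp (1 - ‖x‖)⁻¹))
  rw [key, hN'.tsum_eq]
  exact hs.hasSum

/-- Euler's function `∏ (1 - qⁿ)` on the upper half-plane. -/
noncomputable def eulerH (τ : ℍ) : ℂ := ∏' n : ℕ, (1 - Periodic.qParam 1 τ ^ (n + 1))

theorem eta_eq_eulerH (τ : ℍ) : η τ = Periodic.qParam 24 τ * eulerH τ := rfl

theorem eulerH_ne_zero (τ : ℍ) : eulerH τ ≠ 0 := ModularForm.eta_tprod_ne_zero τ.2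

theorem mdiff_eulerH : MDiff eulerH := by
  rw [UpperHalfPlane.mdifferentiable_iff]
  refine DifferentiableOn.congr
    (fun z hz => (ModularForm.differentiableAt_eta_tprod hz).differentiableWithinAt)
    fun z hz => ?_
  simp [eulerH, ofComplex_apply_of_im_pos hz]

/-- The pentagonal number series with integer coefficients. -/
noncomputable def eulerSeries : PowerSeries ℤ := PowerSeries.pentagonalSeries ℤ

theorem map_eulerSeries :
    eulerSeries.map (Int.castRingHom ℂ) = PowerSeries.pentagonalSeries ℂ := by
  ext n
  simp only [eulerSeries, PowerSeries.pentagonalSeries, PowerSeries.coeff_map,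
    PowerSeries.coeff_mk]
  split_ifs <;> simp

theorem hasQExp_eulerH : HasQExp eulerH (eulerSeries.map (Int.castRingHom ℂ)) := fun τ => by
  rw [map_eulerSeries]
  exact hasSum_pentagonalSeries_tprod (Periodic.norm_qParam_lt_one one_pos τ.im_pos)

theorem constantCoeff_eulerSeries : PowerSeries.constantCoeff eulerSeries = 1 := by
  have := PowerSeries.coeff_pentagonalSeries_pentagonal ℤ 0
  rw [show pentagonal 0 = 0 by rfl, Int.negOnePow_zero] at this
  rw [eulerSeries]
  simpa using this

theorem tendsto_eulerH : Tendsto eulerH atImInfty (𝓝 1) := by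
  have h1 := (cuspFunction_apply_zero one_pos (hasQExp_eulerH.analyticAt mdiff_eulerH)
    hasQExp_eulerH.periodic)
  have h2 := (hasQExp_eulerH.analyticAt mdiff_eulerH).continuousAt.tendsto.comp
    (qParam_tendsto_atImInfty one_pos)
  have h3 : (qExpansion 1 eulerH).coeff 0 = 1 := by
    rw [hasQExp_eulerH.qExpansion_eq mdiff_eulerH]
    simp [constantCoeff_eulerSeries]
  rw [qExpansion_coeff_zero one_pos (hasQExp_eulerH.analyticAt mdiff_eulerH)
    hasQExp_eulerH.periodic] at h3
  rw [h1, h3] at h2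
  refine h2.congr fun τ => ?_
  exact eq_cuspFunction τ one_ne_zero hasQExp_eulerH.periodic

/-- The multiplicative inverse of `eulerSeries`. -/
noncomputable def eulerSeriesInv : PowerSeries ℤ := PowerSeries.invOfUnit eulerSeries 1

theorem eulerSeries_mul_inv : eulerSeries * eulerSeriesInv = 1 :=
  PowerSeries.mul_invOfUnit _ _ (by simp [constantCoeff_eulerSeries])

/-- The product tends to 1 at infinity and has no zeros, so its inverse is bounded there and has
some q-expansion; uniqueness of inverses of power series identifies it. -/
theorem hasQExp_eulerH_inv :
    HasQExp eulerH⁻¹ (eulerSeriesInv.map (Int.castRingHom ℂ)) := by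
  have hd : MDiff eulerH⁻¹ := mdiff_eulerH.inv eulerH_ne_zero
  have hper : Periodic (eulerH⁻¹ ∘ ofComplex) ((1 : ℝ) : ℂ) := fun w => by
    simpa using congrArg (·⁻¹) (hasQExp_eulerH.periodic w)
  have hb : IsBoundedAtImInfty eulerH⁻¹ := by
    have := (tendsto_eulerH.inv₀ one_ne_zero).isBigO_one ℝ
    exact this
  have h := HasQExp.of_qExpansion hper hd hb
  have hm := hasQExp_eulerH.mul h
  rw [show eulerH * eulerH⁻¹ = 1 by ext τ; simp [eulerH_ne_zero]] at hm
  have h1 := hm.unique HasQExp.one mdifferentiable_const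
  have h2 : eulerSeries.map (Int.castRingHom ℂ) * eulerSeriesInv.map (Int.castRingHom ℂ) = 1 := by
    rw [← map_mul, eulerSeries_mul_inv, map_one]
  rw [mul_comm] at h1
  rwa [left_inv_eq_right_inv h1 h2] at h

/-- Integer powers of `eulerSeries`. -/
noncomputable def eulerSeriesZPow : ℤ → PowerSeries ℤ
  | Int.ofNat n => eulerSeries ^ n
  | Int.negSucc n => eulerSeriesInv ^ (n + 1)

theorem hasQExp_eulerH_zpow (e : ℤ) :
    HasQExp (fun τ => eulerH τ ^ e) ((eulerSeriesZPow e).map (Int.castRingHom ℂ)) := by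
  cases e with
  | ofNat n => simpa [eulerSeriesZPow, Pi.pow_def] using hasQExp_eulerH.pow n
  | negSucc n =>
    have : (fun τ => eulerH τ ^ Int.negSucc n) = eulerH⁻¹ ^ (n + 1) := by ext τ; simp
    rw [this, eulerSeriesZPow, map_pow]
    exact hasQExp_eulerH_inv.pow (n + 1)

/-! ### q-expansions of eta quotients -/

section EtaQuotient

variable {ι : Type*} [Fintype ι] (d : ι → ℕ) [∀ i, NeZero (d i)] (e : ι → ℤ)

/-- The eta quotient `∏ η(dᵢ τ) ^ eᵢ`. -/
noncomputable def etaQuot (τ : ℍ) : ℂ := ∏ i, η (d i * τ) ^ e i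

/-- The `q`-expansion of the eta quotient `∏ η(dᵢ τ) ^ eᵢ` with `∑ dᵢ eᵢ = 24 m`. -/
noncomputable def etaQuotSeries (m : ℕ) : PowerSeries ℤ :=
  PowerSeries.X ^ m * ∏ i, (eulerSeriesZPow (e i)).expand (d i) (NeZero.ne (d i))

variable {d e}

theorem etaQuot_eq {m : ℕ} (hm : ∑ i, (d i : ℤ) * e i = 24 * m) (τ : ℍ) :
    etaQuot d e τ = Periodic.qParam 1 τ ^ m * ∏ i, eulerH (scaleH (d i) τ) ^ e i := by
  have h1 (i : ι) : η (d i * τ) = Periodic.qParam 24 (d i * τ) * eulerH (scaleH (d i) τ) := rfl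
  simp_rw [etaQuot, h1, mul_zpow, Finset.prod_mul_distrib]
  congr 1
  simp_rw [Periodic.qParam, ← Complex.exp_int_mul, ← Complex.exp_nat_mul, ← Complex.exp_sum]
  congr 1
  have : ∑ i, (d i : ℂ) * e i = 24 * m := by exact_mod_cast hm
  have h2 : ∀ i, (e i : ℂ) * (2 * Real.pi * Complex.I * (d i * τ) / (24 : ℝ)) =
      (d i * e i) * (2 * Real.pi * Complex.I * τ / 24) := fun i => by push_cast; ring
  simp_rw [h2, ← Finset.sum_mul, this]
  push_cast
  ring

theorem hasQExp_etaQuot {m : ℕ} (hm : ∑ i, (d i : ℤ) * e i = 24 * m) :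
    HasQExp (etaQuot d e) ((etaQuotSeries d e m).map (Int.castRingHom ℂ)) := by
  have h1 : etaQuot d e = (fun τ : ℍ => Periodic.qParam 1 τ) ^ m *
      ∏ i, fun τ : ℍ => eulerH (scaleH (d i) τ) ^ e i := by
    ext τ; simp [etaQuot_eq hm]
  rw [h1, etaQuotSeries, map_mul, map_pow, PowerSeries.map_X, map_prod]
  refine (HasQExp.qParam.pow m).mul (HasQExp.prod fun i _ => ?_)
  rw [PowerSeries.map_expand]
  exact (hasQExp_eulerH_zpow (e i)).scale (d i)

theorem mdiff_eta : MDiff (fun τ : ℍ => η τ) := by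
  rw [UpperHalfPlane.mdifferentiable_iff]
  refine DifferentiableOn.congr (fun z hz =>
    (ModularForm.differentiableAt_eta_of_mem_upperHalfPlaneSet hz).differentiableWithinAt)
    fun z hz => ?_
  simp [ofComplex_apply_of_im_pos hz]

theorem mdiff_zpow {f : ℍ → ℂ} (hf : MDiff f) (h0 : ∀ τ, f τ ≠ 0) (n : ℤ) :
    MDiff (fun τ => f τ ^ n) := by
  cases n with
  | ofNat n =>
    have : (fun τ => f τ ^ Int.ofNat n) = f ^ n := by ext τ; simp
    exact this ▸ hf.pow n
  | negSucc n =>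
    have : (fun τ => f τ ^ Int.negSucc n) = (f ^ (n + 1))⁻¹ := by ext τ; simp
    exact this ▸ (hf.pow (n + 1)).inv fun τ => pow_ne_zero _ (h0 τ)

theorem eta_mul_ne_zero (n : ℕ) [NeZero n] (τ : ℍ) : η (n * τ) ≠ 0 :=
  ModularForm.eta_ne_zero (scaleH n τ).2

variable (d e) in
theorem mdiff_etaQuot : MDiff (etaQuot d e) := by
  have h (i : ι) : MDiff (fun τ : ℍ => η (scaleH (d i) τ) ^ e i) :=
    mdiff_zpow (mdiff_comp_scaleH mdiff_eta (d i)) (fun τ => eta_mul_ne_zero (d i) τ) (e i)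
  rw [UpperHalfPlane.mdifferentiable_iff]
  exact DifferentiableOn.fun_finsetProd fun i _ => UpperHalfPlane.mdifferentiable_iff.mp (h i)

end EtaQuotient

/-! ### The Eisenstein series E₂ and E₄, and Ramanujan's identity -/

/-- The `q`-expansion `1 - 24 ∑ σ(n) qⁿ` of `E₂`. -/
noncomputable def eisSeries₂ : PowerSeries ℤ :=
  PowerSeries.mk fun n => if n = 0 then 1 else -24 * ArithmeticFunction.sigma 1 n

/-- The `q`-expansion `1 + 240 ∑ σ₃(n) qⁿ` of `E₄`. -/
noncomputable def eisSeries₄ : PowerSeries ℤ :=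
  PowerSeries.mk fun n => if n = 0 then 1 else 240 * ArithmeticFunction.sigma 3 n

theorem hasQExp_E2 : HasQExp E2 (eisSeries₂.map (Int.castRingHom ℂ)) := fun τ => by
  convert hasSum_qExpansion_E2 (z := τ) using 2 with n
  simp only [eisSeries₂, PowerSeries.coeff_map, PowerSeries.coeff_mk, smul_eq_mul]
  congr 1
  · split_ifs <;> simp
  · simp [Periodic.qParam]

theorem hasQExp_E₄ : HasQExp ModularForm.E₄ (eisSeries₄.map (Int.castRingHom ℂ)) := fun τ => by
  have h := ModularForm.hasSum_qExpansion (h := 1) ModularForm.E₄ one_pos one_mem_strictPeriods_SL τ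
  convert h using 2 with n
  rw [E_qExpansion_coeff _ ⟨2, rfl⟩]
  simp only [eisSeries₄, PowerSeries.coeff_map, PowerSeries.coeff_mk]
  congr 1
  split_ifs
  · simp
  · norm_num [show bernoulli 4 = -1 / 30 by decide +kernel]

theorem normalizedDeriv_D2 (γ : SL(2, ℤ)) (τ : ℍ) :
    normalizedDerivOfComplex (D2 γ) τ = -(γ 1 0 / denom γ τ) ^ 2 := by
  have h1 := (hasDerivAt_denom_zpow (γ : GL (Fin 2) ℝ) (-1) τ).const_mul
    (2 * Real.pi * Complex.I * γ 1 0)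
  have heq : D2 γ ∘ ofComplex =ᶠ[𝓝 (τ : ℂ)]
      fun w => 2 * Real.pi * Complex.I * γ 1 0 * denom γ w ^ (-1 : ℤ) := by
    filter_upwards [isOpen_upperHalfPlaneSet.mem_nhds τ.im_pos] with w hw
    simp [D2, ofComplex_apply_of_im_pos hw, div_eq_mul_inv]
  rw [normalizedDerivOfComplex, heq.deriv_eq, h1.deriv]
  have : (2 * Real.pi * Complex.I : ℂ) ≠ 0 := by simp [Real.pi_ne_zero]
  have hj := denom_ne_zero (γ : GL (Fin 2) ℝ) τ
  simp only [zpow_sub_one₀ hj, zpow_neg, zpow_one]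
  simp
  field_simp
  simp

/-- The right-hand side of Ramanujan's formula for the derivative of `E₂` is modular. -/
theorem E2_sq_sub_deriv_slash (γ : SL(2, ℤ)) :
    (E2 * E2 - (12 : ℂ) • normalizedDerivOfComplex E2) ∣[(4 : ℤ)] γ =
      E2 * E2 - (12 : ℂ) • normalizedDerivOfComplex E2 := by
  have hE := E2_slash_action γ
  have hD := normalizedDerivOfComplex_SL_slash (k := 2) E2_mdifferentiable (γ := γ)
  have hmul := ModularForm.mul_slash_SL2 2 2 γ E2 E2
  norm_num at hmul hD
  have hD2 : MDiff (D2 γ) := by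
    have h0 : MDiff (E2 ∣[(2 : ℤ)] γ) := E2_mdifferentiable.slash 2 (γ : GL (Fin 2) ℝ)
    have : D2 γ = (2 * riemannZeta 2) • (E2 - E2 ∣[(2 : ℤ)] γ) := by
      rw [hE]
      ext τ
      have : riemannZeta 2 ≠ 0 := by rw [riemannZeta_two]; simp [Real.pi_ne_zero]
      simp; field_simp
    rw [this]
    exact (E2_mdifferentiable.sub h0).const_smul _
  -- Differentiating the transformation law of E₂ gives that of its derivative. The terms in
  -- E₂·c/(cz+d) and in (c/(cz+d))² then cancel against those of E₂².
  rw [hE, normalizedDerivOfComplex_sub _ _ E2_mdifferentiable (hD2.const_smul _),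
    normalizedDerivOfComplex_smul _ _ hD2] at hD
  rw [sub_eq_add_neg, SlashAction.add_slash, SlashAction.neg_slash, ModularForm.SL_smul_slash, hmul, hE]
  ext τ
  have hDτ := congrFun hD τ
  simp only [Pi.sub_apply, Pi.smul_apply, Pi.mul_apply, smul_eq_mul, normalizedDeriv_D2, Pi.add_apply,
    Pi.neg_apply, D2, riemannZeta_two] at hDτ ⊢
  rw [eq_sub_iff_add_eq] at hDτ
  rw [← hDτ]
  have hj := denom_ne_zero (γ : GL (Fin 2) ℝ) τ
  have hpi : (Real.pi : ℂ) ≠ 0 := by simp [Real.pi_ne_zero]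
  field_simp
  ring_nf
  simp only [Complex.I_sq]
  ring

/-- The normalized derivative is q d/dq: if F is the cusp function, it equals q F′(q), and the
Taylor series of F′ gives the coefficients. -/
theorem HasQExp.normalizedDeriv {f : ℍ → ℂ} {p : PowerSeries ℂ} (hf : HasQExp f p) (hd : MDiff f) :
    HasQExp (normalizedDerivOfComplex f) (PowerSeries.mk fun n => n * p.coeff n) := fun τ => by
  set F := cuspFunction 1 f
  have hF : DifferentiableOn ℂ F (Metric.ball 0 1) :=
    differentiableOn_cuspFunction_ball one_pos hf.periodic hd hf.isBoundedAtImInfty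
  have hF' := hF.deriv Metric.isOpen_ball
  set q := Periodic.qParam 1 τ
  have hq : ‖q‖ < 1 := Periodic.norm_qParam_lt_one one_pos τ.im_pos
  have hT := (Complex.hasSum_taylorSeries_on_ball hF' (z := q) (by simpa using hq)).mul_left q
  have hval : normalizedDerivOfComplex f τ = q * deriv F q := by
    have heq : f ∘ ofComplex =ᶠ[𝓝 (τ : ℂ)] F ∘ Periodic.qParam 1 := by
      filter_upwards [isOpen_upperHalfPlaneSet.mem_nhds τ.im_pos] with w hw
      simp only [comp_apply, ofComplex_apply_of_im_pos hw]
      exact (eq_cuspFunction ⟨w, hw⟩ one_ne_zero hf.periodic).symm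
    have h1 : HasDerivAt (Periodic.qParam 1) (q * (2 * Real.pi * Complex.I)) τ := by
      have : HasDerivAt (fun w : ℂ => 2 * Real.pi * Complex.I * w / ((1 : ℝ) : ℂ))
          (2 * Real.pi * Complex.I) (τ : ℂ) := by
        simpa using ((hasDerivAt_id (τ : ℂ)).const_mul (2 * Real.pi * Complex.I)).div_const
          ((1 : ℝ) : ℂ)
      exact this.cexp
    have h2 : HasDerivAt F (deriv F q) q :=
      (hF.differentiableAt (Metric.isOpen_ball.mem_nhds (by simpa using hq))).hasDerivAt
    rw [normalizedDerivOfComplex, heq.deriv_eq, (h2.comp (τ : ℂ) h1).deriv]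
    have : (2 * Real.pi * Complex.I : ℂ) ≠ 0 := by simp [Real.pi_ne_zero]
    field_simp
  rw [hval]
  rw [← hasSum_nat_add_iff' 1]
  have hp (n : ℕ) : p.coeff n = (n.factorial : ℂ)⁻¹ * iteratedDeriv n F 0 := by
    rw [← hf.qExpansion_eq hd, qExpansion_coeff]
  simp only [Finset.range_one, Finset.sum_singleton, PowerSeries.coeff_mk, Nat.cast_zero, zero_mul,
    sub_zero]
  convert! hT using 2 with n
  rw [hp, ← iteratedDeriv_succ', Nat.factorial_succ]
  have : (n.factorial : ℂ) ≠ 0 := by exact_mod_cast n.factorial_ne_zero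
  have h2 : ((n : ℂ) + 1) ≠ 0 := by exact_mod_cast n.succ_ne_zero
  simp only [smul_eq_mul, sub_zero]
  push_cast
  field_simp
  ring


theorem mdiff_E2_sq_sub_deriv : MDiff (E2 * E2 - (12 : ℂ) • normalizedDerivOfComplex E2) :=
  (E2_mdifferentiable.mul E2_mdifferentiable).sub
    ((normalizedDerivOfComplex_mdifferentiable E2_mdifferentiable).const_smul _)

/-- The modular form `E₂² - 12 D E₂` of weight four and level one. -/
noncomputable def ramanujanForm : ModularForm 𝒮ℒ 4 where
  toFun := E2 * E2 - (12 : ℂ) • normalizedDerivOfComplex E2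
  slash_action_eq' := fun _ ⟨γ, hγ⟩ => hγ ▸ E2_sq_sub_deriv_slash γ
  holo' := mdiff_E2_sq_sub_deriv
  bdd_at_cusps' {c} hc := by
    rw [Subgroup.IsArithmetic.isCusp_iff_isCusp_SL2Z] at hc
    rw [OnePoint.isBoundedAt_iff_forall_SL2Z hc]
    intro γ _
    rw [E2_sq_sub_deriv_slash]
    exact ((hasQExp_E2.mul hasQExp_E2).sub
      ((hasQExp_E2.normalizedDeriv E2_mdifferentiable).smul _)).isBoundedAtImInfty

/-- In weight 4 and level one the Sturm bound is 4/12 < 1, so the constant term decides, and both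
constant terms are 1. -/
theorem ramanujanForm_eq_E₄ : ramanujanForm = ModularForm.E₄ := by
  rw [← sub_eq_zero]
  apply ModularForm.sturm_bound_levelOne
  have h := ((hasQExp_E2.mul hasQExp_E2).sub
      ((hasQExp_E2.normalizedDeriv E2_mdifferentiable).smul 12)).sub hasQExp_E₄
  have hd : MDiff (ramanujanForm - ModularForm.E₄ : ModularForm 𝒮ℒ 4) :=
    (ramanujanForm - ModularForm.E₄).holo'
  rw [HasQExp.qExpansion_eq (f := (ramanujanForm - ModularForm.E₄ : ModularForm 𝒮ℒ 4)) h hd]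
  refine lt_of_lt_of_le (b := 1) (by simp) ?_
  refine PowerSeries.le_order _ _ fun i hi => ?_
  obtain rfl : i = 0 := by
    have : i < 1 := by exact_mod_cast hi
    omega
  have h2 : PowerSeries.constantCoeff (eisSeries₂.map (Int.castRingHom ℂ)) = 1 := by
    rw [← PowerSeries.coeff_zero_eq_constantCoeff_apply, PowerSeries.coeff_map, eisSeries₂,
      PowerSeries.coeff_mk]
    simp
  have h4 : PowerSeries.constantCoeff (eisSeries₄.map (Int.castRingHom ℂ)) = 1 := by
    rw [← PowerSeries.coeff_zero_eq_constantCoeff_apply, PowerSeries.coeff_map, eisSeries₄,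
      PowerSeries.coeff_mk]
    simp
  simp [h2, h4]

/-- Ramanujan's formula for the derivative of `E₂`, in terms of coefficients. -/
theorem eisSeries₂_sq : eisSeries₂ * eisSeries₂ =
    eisSeries₄ + PowerSeries.mk fun n => 12 * n * eisSeries₂.coeff n := by
  have h1 : HasQExp (ramanujanForm : ℍ → ℂ) _ := ((hasQExp_E2.mul hasQExp_E2).sub
      ((hasQExp_E2.normalizedDeriv E2_mdifferentiable).smul 12))
  rw [ramanujanForm_eq_E₄] at h1
  have h2 := h1.unique hasQExp_E₄ ModularForm.E₄.holo'
  apply PowerSeries.map_injective (Int.castRingHom ℂ) Int.cast_injective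
  rw [map_mul, map_add, ← h2]
  ext n
  simp [mul_assoc]

/-! ### The multiplier of the eta function -/

/-- The root of unity `exp (2 π i n / 24)`. -/
noncomputable def e24 (n : ℤ) : ℂ := Complex.exp (2 * Real.pi * Complex.I * n / 24)

theorem e24_add (m n : ℤ) : e24 (m + n) = e24 m * e24 n := by
  rw [e24, e24, e24, ← Complex.exp_add]; congr 1; push_cast; ring

theorem e24_zero : e24 0 = 1 := by simp [e24]

theorem e24_eq_one {n : ℤ} (h : 24 ∣ n) : e24 n = 1 := by
  obtain ⟨k, rfl⟩ := h
  rw [e24, Complex.exp_eq_one_iff]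
  exact ⟨k, by push_cast; ring⟩

theorem e24_congr {m n : ℤ} (h : 24 ∣ m - n) : e24 m = e24 n := by
  rw [← sub_add_cancel m n, e24_add, e24_eq_one h, one_mul]

theorem e24_ne_zero (n : ℤ) : e24 n ≠ 0 := Complex.exp_ne_zero _

theorem e24_zpow (m n : ℤ) : e24 m ^ n = e24 (n * m) := by
  rw [e24, e24, ← Complex.exp_int_mul]; congr 1; push_cast; ring

theorem e24_sum {ι : Type*} (s : Finset ι) (f : ι → ℤ) : e24 (∑ i ∈ s, f i) = ∏ i ∈ s, e24 (f i) := by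
  classical
  induction s using Finset.induction_on with
  | empty => simp [e24_zero]
  | insert i s hi ih => rw [Finset.sum_insert hi, Finset.prod_insert hi, e24_add, ih]

theorem e24_twelve_mul (n : ℤ) : e24 (12 * n) = (-1) ^ n := by
  rw [mul_comm, ← e24_zpow, e24, show (2 * Real.pi * Complex.I * ((12 : ℤ) : ℂ) / 24 : ℂ) =
    Real.pi * Complex.I by push_cast; ring, Complex.exp_pi_mul_I]

theorem dvd_24_of_zmod {n : ℤ} (h8 : (n : ZMod 8) = 0) (h3 : (n : ZMod 3) = 0) : 24 ∣ n := by
  have h8' : (8 : ℤ) ∣ n := by exact_mod_cast (ZMod.intCast_zmod_eq_zero_iff_dvd n 8).mp h8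
  have h3' : (3 : ℤ) ∣ n := by exact_mod_cast (ZMod.intCast_zmod_eq_zero_iff_dvd n 3).mp h3
  omega

/-- Modulo x + y the numerator is −x; reciprocity exchanges x and x + y, and x + y ≡ y modulo x. The
sign collects the symbol of −1 and the reciprocity factor. -/
theorem jacobiSym_add_even {x y : ℕ} (hx : Odd x) (hy : Even y) :
    J((y : ℤ) | x + y) = (-1) ^ ((x + y) / 2 * (1 + x / 2)) * J((y : ℤ) | x) := by
  have hxy : Odd (x + y) := hx.add_even hy
  have h1 : J((y : ℤ) | x + y) = J(-(x : ℤ) | x + y) := by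
    apply jacobiSym.mod_left'
    rw [← Int.ModEq, Int.modEq_comm, Int.modEq_iff_dvd]
    exact ⟨1, by push_cast; ring⟩
  have h2 : J((y : ℤ) | x) = J(((x + y : ℕ) : ℤ) | x) := by
    apply jacobiSym.mod_left'
    push_cast
    simp
  rw [h1, jacobiSym.neg _ hxy, jacobiSym.quadratic_reciprocity hx hxy, h2,
    ZMod.χ₄_eq_neg_one_pow (Nat.odd_iff.mp hxy), ← mul_assoc, ← pow_add]
  congr 2
  ring

/-- The part of the exponent of the eta multiplier that does not depend on parities. -/
def etaExpo (a b c d : ℤ) : ℤ := (a + d) * c - b * d * (c ^ 2 - 1)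

/-- The eta multiplier of the matrix `(a b; c d)` with `c, d ≥ 0`. -/
noncomputable def etaMult (a b : ℤ) (c d : ℕ) : ℂ :=
  if Odd d then J((c : ℤ) | d) * e24 (etaExpo a b c d + 3 * d - 3 - 3 * c * d)
  else J((d : ℤ) | c) * e24 (etaExpo a b c d - 3 * c)

/-- When c and d are both odd, the two branches of the definition agree by quadratic reciprocity,
its sign being absorbed into a 24th root of unity. -/
theorem etaMult_of_odd_left (a b : ℤ) {c : ℕ} (d : ℕ) (hc : Odd c) :
    etaMult a b c d = J((d : ℤ) | c) * e24 (etaExpo a b c d - 3 * c) := by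
  by_cases hd : Odd d
  · rw [etaMult, if_pos hd, jacobiSym.quadratic_reciprocity hc hd]
    obtain ⟨k, rfl⟩ := hc
    obtain ⟨l, rfl⟩ := hd
    have h1 : (2 * k + 1) / 2 = k := by omega
    have h2 : (2 * l + 1) / 2 = l := by omega
    rw [h1, h2]
    push_cast
    have h3 : ((-1 : ℂ)) ^ (k * l) = e24 (12 * (k * l)) := by
      rw [e24_twelve_mul]; norm_cast
    rw [h3, mul_comm (e24 _), mul_assoc, ← e24_add]
    congr 1
    apply e24_congr
    exact ⟨0, by ring⟩
  · rw [etaMult, if_neg hd]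

/-- Compatibility with right multiplication by (1 0; 1 1), that is with z ↦ z/(z + 1), whose own
multiplier is `e24 (-1)`. -/
theorem etaMult_lower (a b : ℤ) (c d : ℕ) (h : a * d - b * c = 1) :
    etaMult (a + b) b (c + d) d = etaMult a b c d * e24 (-1) := by
  by_cases hd : Odd d
  · rw [etaMult, etaMult, if_pos hd, if_pos hd]
    have h1 : J(((c + d : ℕ) : ℤ) | d) = J((c : ℤ) | d) := by
      apply jacobiSym.mod_left'
      push_cast
      simp
    rw [h1, mul_assoc (_ : ℂ) (e24 _) (e24 _), ← e24_add]
    congr 1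
    apply e24_congr
    obtain ⟨k, rfl⟩ := hd
    -- The congruence modulo 24 is split into 8 and 3 and checked on all residues satisfying the
    -- determinant relation.
    have h8 := congrArg (Int.cast : ℤ → ZMod 8) h
    have h3 := congrArg (Int.cast : ℤ → ZMod 3) h
    push_cast at h8 h3
    apply dvd_24_of_zmod <;> simp only [etaExpo] <;> push_cast
    · generalize (a : ZMod 8) = a, (b : ZMod 8) = b, (c : ZMod 8) = c, (k : ZMod 8) = k at *
      revert a b c k; decide +kernel
    · generalize (a : ZMod 3) = a, (b : ZMod 3) = b, (c : ZMod 3) = c, (k : ZMod 3) = k at *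
      revert a b c k; decide +kernel
  · rw [etaMult, etaMult, if_neg hd, if_neg hd]
    rw [Nat.not_odd_iff_even] at hd
    have hc : Odd c := by
      by_contra hc
      rw [Nat.not_odd_iff_even] at hc
      obtain ⟨k, rfl⟩ := hc
      obtain ⟨l, rfl⟩ := hd
      have : a * l - b * k = 1 - (a * l - b * k) := by push_cast at h; linarith
      omega
    rw [jacobiSym_add_even hc hd]
    obtain ⟨k, rfl⟩ := hc
    obtain ⟨l, rfl⟩ := hd.two_dvd
    rw [show (2 * k + 1 + 2 * l) / 2 = k + l by omega, show (2 * k + 1) / 2 = k by omega]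
    push_cast
    rw [show ((-1 : ℂ)) ^ ((k + l) * (1 + k)) = e24 (12 * ((k + l) * (1 + k))) by
      rw [e24_twelve_mul]; norm_cast, mul_comm (e24 _), mul_assoc (_ : ℂ) (e24 _) (e24 _),
      mul_assoc (_ : ℂ) (e24 _) (e24 _), ← e24_add, ← e24_add]
    congr 1
    apply e24_congr
    have h8 := congrArg (Int.cast : ℤ → ZMod 8) h
    have h3 := congrArg (Int.cast : ℤ → ZMod 3) h
    push_cast at h8 h3
    apply dvd_24_of_zmod <;> simp only [etaExpo] <;> push_cast
    · generalize (a : ZMod 8) = a, (b : ZMod 8) = b, (l : ZMod 8) = l, (k : ZMod 8) = k at *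
      revert a b l k; decide +kernel
    · generalize (a : ZMod 3) = a, (b : ZMod 3) = b, (l : ZMod 3) = l, (k : ZMod 3) = k at *
      revert a b l k; decide +kernel

/-- Compatibility with right multiplication by (1 1; 0 1), that is with z ↦ z + 1. The parity roles
of c and d are exchanged. -/
theorem etaMult_upper (a b : ℤ) (c d : ℕ) (h : a * d - b * c = 1) :
    etaMult a (a + b) c (c + d) = etaMult a b c d * e24 1 := by
  by_cases hc : Odd c
  · rw [etaMult_of_odd_left _ _ _ hc, etaMult_of_odd_left _ _ _ hc]
    have h1 : J(((c + d : ℕ) : ℤ) | c) = J((d : ℤ) | c) := by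
      apply jacobiSym.mod_left'
      push_cast
      simp
    rw [h1, mul_assoc (_ : ℂ) (e24 _) (e24 _), ← e24_add]
    congr 1
    apply e24_congr
    obtain ⟨k, rfl⟩ := hc
    have h8 := congrArg (Int.cast : ℤ → ZMod 8) h
    have h3 := congrArg (Int.cast : ℤ → ZMod 3) h
    push_cast at h8 h3
    apply dvd_24_of_zmod <;> simp only [etaExpo] <;> push_cast
    · generalize (a : ZMod 8) = a, (b : ZMod 8) = b, (d : ZMod 8) = d, (k : ZMod 8) = k at *
      revert a b d k; decide +kernel
    · generalize (a : ZMod 3) = a, (b : ZMod 3) = b, (d : ZMod 3) = d, (k : ZMod 3) = k at *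
      revert a b d k; decide +kernel
  · rw [Nat.not_odd_iff_even] at hc
    have hd : Odd d := by
      by_contra hd
      rw [Nat.not_odd_iff_even] at hd
      obtain ⟨k, rfl⟩ := hc
      obtain ⟨l, rfl⟩ := hd
      have : a * l - b * k = 1 - (a * l - b * k) := by push_cast at h; linarith
      omega
    rw [add_comm c d, etaMult, etaMult, if_pos hd, if_pos (hd.add_even hc),
      jacobiSym_add_even hd hc]
    obtain ⟨l, rfl⟩ := hd
    obtain ⟨k, rfl⟩ := hc.two_dvd
    rw [show (2 * l + 1 + 2 * k) / 2 = l + k by omega, show (2 * l + 1) / 2 = l by omega]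
    push_cast
    rw [show ((-1 : ℂ)) ^ ((l + k) * (1 + l)) = e24 (12 * ((l + k) * (1 + l))) by
      rw [e24_twelve_mul]; norm_cast, mul_comm (e24 _), mul_assoc (_ : ℂ) (e24 _) (e24 _),
      mul_assoc (_ : ℂ) (e24 _) (e24 _), ← e24_add, ← e24_add]
    congr 1
    apply e24_congr
    have h8 := congrArg (Int.cast : ℤ → ZMod 8) h
    have h3 := congrArg (Int.cast : ℤ → ZMod 3) h
    push_cast at h8 h3
    apply dvd_24_of_zmod <;> simp only [etaExpo] <;> push_cast
    · generalize (a : ZMod 8) = a, (b : ZMod 8) = b, (l : ZMod 8) = l, (k : ZMod 8) = k at *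
      revert a b l k; decide +kernel
    · generalize (a : ZMod 3) = a, (b : ZMod 3) = b, (l : ZMod 3) = l, (k : ZMod 3) = k at *
      revert a b l k; decide +kernel

/-- The two sides have equal squares. The principal roots of x and y lie in the closed first
quadrant, so their product has nonnegative imaginary part, while the root of xy has positive
imaginary part; this excludes the minus sign. -/
theorem csqrt_mul_csqrt {x y : ℂ} (hx : 0 ≤ x.im) (hy : 0 ≤ y.im) (hxy : 0 < (x * y).im) :
    x ^ (2⁻¹ : ℂ) * y ^ (2⁻¹ : ℂ) = (x * y) ^ (2⁻¹ : ℂ) := by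
  have hsq (w : ℂ) : (w ^ (2⁻¹ : ℂ)) ^ 2 = w := by
    simp
  have h : (x ^ (2⁻¹ : ℂ) * y ^ (2⁻¹ : ℂ)) ^ 2 = ((x * y) ^ (2⁻¹ : ℂ)) ^ 2 := by
    rw [mul_pow, hsq, hsq, hsq]
  rcases sq_eq_sq_iff_eq_or_eq_neg.mp h with h | h
  · exact h
  · have h1 : 0 ≤ (x ^ (2⁻¹ : ℂ) * y ^ (2⁻¹ : ℂ)).im := by
      rw [Complex.mul_im, Complex.cpow_inv_two_re, Complex.cpow_inv_two_re,
        Complex.cpow_inv_two_im_eq_sqrt hx, Complex.cpow_inv_two_im_eq_sqrt hy]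
      positivity
    have h2 : 0 < ((x * y) ^ (2⁻¹ : ℂ)).im := by
      rw [Complex.cpow_inv_two_im_eq_sqrt hxy.le, Real.sqrt_pos]
      have := Complex.re_le_norm (x * y)
      have h3 : (x * y).re ≠ ‖x * y‖ := fun h => by
        have := Complex.sq_norm_sub_sq_re (x * y)
        rw [h] at this
        nlinarith
      have := lt_of_le_of_ne this h3
      linarith
    rw [h, Complex.neg_im] at h1
    linarith

theorem eta_add_one (z : ℂ) : η (z + 1) = e24 1 * η z := by
  have h : Periodic.qParam 1 (z + 1) = Periodic.qParam 1 z := by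
    simp [Periodic.qParam, mul_add, Complex.exp_add]
  rw [ModularForm.eta, ModularForm.eta]
  simp only [ModularForm.eta_q, h]
  rw [← mul_assoc]
  congr 1
  rw [e24, Periodic.qParam, Periodic.qParam, ← Complex.exp_add]
  congr 1
  push_cast
  ring

theorem eta_add_int (z : ℂ) (n : ℤ) : η (z + n) = e24 n * η z := by
  induction n with
  | zero => simp [e24_zero]
  | succ n ih =>
    push_cast at ih ⊢
    rw [← add_assoc, eta_add_one, ih, add_comm (n : ℤ) 1, e24_add, mul_assoc]
  | pred n ih =>
    have := eta_add_one (z + ((-n - 1 : ℤ) : ℂ))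
    rw [add_assoc, show ((-n - 1 : ℤ) : ℂ) + 1 = ((-n : ℤ) : ℂ) by push_cast; ring, ih] at this
    rw [show e24 (-(n : ℤ)) = e24 1 * e24 (-n - 1) by rw [← e24_add]; ring_nf, mul_assoc] at this
    exact (mul_left_cancel₀ (e24_ne_zero 1) this).symm

theorem csqrt_I : Complex.I ^ (2⁻¹ : ℂ) = e24 3 := by
  rw [Complex.cpow_def_of_ne_zero Complex.I_ne_zero, Complex.log_I, e24]
  congr 1
  push_cast
  ring

theorem csqrt_ne_zero {z : ℂ} (hz : 0 < z.im) : z ^ (2⁻¹ : ℂ) ≠ 0 := by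
  have : z ≠ 0 := fun h => by simp [h] at hz
  simp [Complex.cpow_eq_zero_iff, this]

theorem eta_neg_inv {z : ℂ} (hz : 0 < z.im) :
    η (-1 / z) = e24 (-3) * z ^ (2⁻¹ : ℂ) * η z := by
  have h := ModularForm.eta_comp_eq_csqrt_I_inv (show z ∈ upperHalfPlaneSet from hz)
  have h3 : e24 (-3) = (e24 3)⁻¹ := by
    apply eq_inv_of_mul_eq_one_left
    rw [← e24_add]
    exact e24_zero
  simpa [Complex.sqrt, csqrt_I, h3, mul_assoc] using h

theorem im_mobius {z : ℂ} (hz : 0 < z.im) {a b c d : ℝ} (h : a * d - b * c = 1) :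
    0 < ((a * z + b) / (c * z + d)).im := by
  have hne : (c * z + d) ≠ 0 := by
    intro h0
    have h1 := congrArg Complex.im h0
    have h2 := congrArg Complex.re h0
    simp at h1 h2
    rcases h1 with h1 | h1
    · rw [h1] at h2 h; simp at h2; rw [h2] at h; simp at h
    · exact hz.ne' h1
  have : ((a * z + b) / (c * z + d)).im = z.im / Complex.normSq (c * z + d) := by
    rw [Complex.div_im]
    simp
    linear_combination z.im / Complex.normSq (c * z + d) * h
  rw [this]
  exact div_pos hz (Complex.normSq_pos.mpr hne)

/-- Inverting z/(z + 1) gives −1/z − 1, so the law follows from inversion applied at z/(z + 1) and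
at z, together with one translation. -/
theorem eta_lower {z : ℂ} (hz : 0 < z.im) :
    η (z / (z + 1)) = e24 (-1) * (z + 1) ^ (2⁻¹ : ℂ) * η z := by
  have hz0 : z ≠ 0 := fun h => by simp [h] at hz
  have hz1 : z + 1 ≠ 0 := fun h => by
    have := congrArg Complex.im h; simp at this; exact hz.ne' this
  have hu : 0 < (z / (z + 1)).im := by
    simpa using im_mobius hz (a := 1) (b := 0) (c := 1) (d := 1) (by norm_num)
  have h1 := eta_neg_inv hu
  have h2 : -1 / (z / (z + 1)) = -1 / z + ((-1 : ℤ) : ℂ) := by field_simp; push_cast; ring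
  have h3 : z / (z + 1) * (z + 1) = z := by field_simp
  rw [h2, eta_add_int, eta_neg_inv hz] at h1
  have h4 : (z / (z + 1)) ^ (2⁻¹ : ℂ) * (z + 1) ^ (2⁻¹ : ℂ) = z ^ (2⁻¹ : ℂ) := by
    rw [csqrt_mul_csqrt hu.le (by simpa using hz.le) (by rw [h3]; exact hz), h3]
  rw [← h4] at h1
  apply mul_left_cancel₀ (mul_ne_zero (e24_ne_zero (-3)) (csqrt_ne_zero hu))
  rw [← h1]
  ring

/-- The transformation law of the Dedekind eta function under `(a b; c d)` with `c, d ≥ 0`. -/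
theorem eta_mobius (a b : ℤ) (c d : ℕ) (h : a * d - b * c = 1) {z : ℂ} (hz : 0 < z.im) :
    η ((a * z + b) / (c * z + d)) = etaMult a b c d * (c * z + d) ^ (2⁻¹ : ℂ) * η z := by
  -- Euclid's algorithm on the bottom row: subtracting the smaller entry from the larger strips one
  -- elementary matrix on the right, down to a translation (c = 0) or an inversion followed by a
  -- translation (d = 0).
  induction hn : c + d using Nat.strong_induction_on generalizing a b c d z with
  | _ n ih =>
    rcases Nat.eq_zero_or_pos c with rfl | hc
    · have hd : d = 1 := by
        have : (d : ℤ) ∣ 1 := ⟨a, by simp at h; linarith⟩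
        exact_mod_cast Int.natAbs_dvd_natAbs.mpr this |> Nat.dvd_one.mp
      subst hd
      obtain rfl : a = 1 := by simpa using h
      have : etaMult 1 b 0 1 = e24 b := by
        rw [etaMult, if_pos odd_one]; simp [etaExpo]
      simp [this, eta_add_int]
    rcases Nat.eq_zero_or_pos d with rfl | hd
    · have hc1 : c = 1 := by
        have : (c : ℤ) ∣ 1 := ⟨-b, by simp at h; linarith⟩
        exact_mod_cast Int.natAbs_dvd_natAbs.mpr this |> Nat.dvd_one.mp
      subst hc1
      obtain rfl : b = -1 := by simp at h; linarith
      have hz0 : z ≠ 0 := fun h => by simp [h] at hz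
      have : etaMult a (-1) 1 0 = e24 (a - 3) := by
        rw [etaMult, if_neg (by simp)]; simp [etaExpo]
      have h2 : (a * z + ((-1 : ℤ) : ℂ)) / ((1 : ℕ) * z + (0 : ℕ)) = -1 / z + a := by
        push_cast; rw [one_mul, add_zero]; field_simp; ring
      rw [h2, eta_add_int, eta_neg_inv hz, this, sub_eq_add_neg, e24_add]
      simp
      ring
    rcases le_or_gt d c with hdc | hcd
    · obtain ⟨c', rfl⟩ := Nat.exists_eq_add_of_le' hdc
      obtain ⟨a', rfl⟩ : ∃ a', a = a' + b := ⟨a - b, by ring⟩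
      have h' : a' * d - b * c' = 1 := by push_cast at h; linarith
      have hz1 : z + 1 ≠ 0 := fun h => by
        have := congrArg Complex.im h; simp at this; exact hz.ne' this
      have hu : 0 < (z / (z + 1)).im := by
        simpa using im_mobius hz (a := 1) (b := 0) (c := 1) (d := 1) (by norm_num)
      have hi := ih (c' + d) (by omega) a' b c' d h' hu rfl
      rw [eta_lower hz] at hi
      have h3 : (c' * (z / (z + 1)) + d) * (z + 1) = ((c' + d : ℕ) : ℂ) * z + d := by
        push_cast; field_simp; ring
      have h4 : (a' * (z / (z + 1)) + b) / (c' * (z / (z + 1)) + d) =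
          (((a' + b : ℤ) : ℂ) * z + b) / (((c' + d : ℕ) : ℂ) * z + d) := by
        rw [← h3, ← mul_div_mul_right _ _ hz1]
        congr 1
        push_cast; field_simp; ring
      have h5 := csqrt_mul_csqrt (x := c' * (z / (z + 1)) + d) (y := z + 1)
        (by simpa using mul_nonneg (Nat.cast_nonneg c') hu.le) (by simpa using hz.le)
        (by rw [h3]; simpa using mul_pos (by positivity) hz)
      rw [h3] at h5
      rw [← h4, hi, etaMult_lower _ _ _ _ h', ← h5]
      ring
    · obtain ⟨d', rfl⟩ := Nat.exists_eq_add_of_le hcd.le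
      obtain ⟨b', rfl⟩ : ∃ b', b = a + b' := ⟨b - a, by ring⟩
      have h' : a * d' - b' * c = 1 := by push_cast at h; linarith
      have hi := ih (c + d') (by omega) a b' c d' h' (z := z + 1) (by simpa using hz) rfl
      rw [eta_add_one] at hi
      rw [etaMult_upper _ _ _ _ h']
      push_cast
      rw [show (a : ℂ) * z + (a + b') = a * (z + 1) + b' by ring,
        show (c : ℂ) * z + (c + d') = c * (z + 1) + d' by ring, hi]
      ring

/-! ### Transformation of eta quotients under Γ₀(N) -/

theorem cast_zpow_eq_pow_natAbs {x : ℤ} (hx : x = 1 ∨ x = -1) (e : ℤ) :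
    (x : ℂ) ^ e = ((x ^ e.natAbs : ℤ) : ℂ) := by
  cases e <;> rcases hx with rfl | rfl
  · simp
  · simp
  · simp
  · simp only [Int.natAbs_negSucc, zpow_negSucc]
    push_cast
    rw [← inv_pow]
    norm_num

theorem zpow_sum {ι : Type*} {x : ℂ} (hx : x ≠ 0) (s : Finset ι) (f : ι → ℤ) :
    x ^ (∑ i ∈ s, f i) = ∏ i ∈ s, x ^ f i := by
  classical
  induction s using Finset.induction_on with
  | empty => simp
  | insert i s hi ih => rw [Finset.sum_insert hi, Finset.prod_insert hi, zpow_add₀ hx, ih]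

section EtaQuotient

variable {ι : Type*} [Fintype ι] {d : ι → ℕ} {e : ι → ℤ} {N : ℕ}

/-- All symbols are ±1, so exponents may be replaced by absolute values and the symbol of cᵢ is that
of C times that of dᵢ. The symbol of C occurs to an even total power, and the dᵢ multiply to a
square. -/
theorem prod_jacobiSym_zpow (he : Even (∑ i, (e i).natAbs))
    (hs : IsSquare (∏ i, d i ^ (e i).natAbs)) {c : ι → ℕ} {C δ : ℕ} (hc : ∀ i, c i * d i = C)
    (hCD : Nat.Coprime C δ) : ∏ i, (J((c i : ℤ) | δ) : ℂ) ^ e i = 1 := by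
  have hcop (i : ι) : Nat.Coprime (c i) δ := hCD.coprime_dvd_left ⟨_, (hc i).symm⟩
  have hdop (i : ι) : Nat.Coprime (d i) δ := hCD.coprime_dvd_left ⟨c i, by rw [mul_comm, hc i]⟩
  have hunit {x : ℕ} (hx : Nat.Coprime x δ) : J((x : ℤ) | δ) = 1 ∨ J((x : ℤ) | δ) = -1 :=
    jacobiSym.eq_one_or_neg_one (by simpa [Int.gcd_natCast_natCast] using hx)
  have h1 (i : ι) : J((c i : ℤ) | δ) = J((C : ℤ) | δ) * J((d i : ℤ) | δ) := by
    rw [← hc i, Nat.cast_mul, jacobiSym.mul_left, mul_assoc]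
    rcases hunit (hdop i) with h | h <;> rw [h] <;> norm_num
  simp_rw [fun i => cast_zpow_eq_pow_natAbs (hunit (hcop i)) (e i)]
  rw [← Int.cast_prod]
  simp_rw [h1, mul_pow, ← jacobiSym.pow_left]
  rw [Finset.prod_mul_distrib]
  simp_rw [jacobiSym.pow_left]
  rw [Finset.prod_pow_eq_pow_sum]
  have h2 : J((C : ℤ) | δ) ^ (∑ i, (e i).natAbs) = 1 := by
    rcases hunit hCD with h | h <;> rw [h]
    · simp
    · exact he.neg_one_pow
  have h3 : ∏ i, J((d i : ℤ) | δ) ^ (e i).natAbs = 1 := by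
    have (s : Finset ι) : ∏ i ∈ s, J((d i : ℤ) | δ) ^ (e i).natAbs =
        J(((∏ i ∈ s, d i ^ (e i).natAbs : ℕ) : ℤ) | δ) := by
      classical
      induction s using Finset.induction_on with
      | empty => simp [jacobiSym.one_left]
      | insert i s hi ih =>
        rw [Finset.prod_insert hi, Finset.prod_insert hi, ih, Nat.cast_mul, jacobiSym.mul_left,
          Nat.cast_pow, jacobiSym.pow_left]
    rw [this]
    obtain ⟨s, h⟩ := hs
    have hcs : Nat.Coprime (s * s) δ := h ▸ Nat.Coprime.prod_left fun i _ => (hdop i).pow_left _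
    rw [h, Nat.cast_mul, ← sq]
    exact jacobiSym.sq_one' (by
      simpa [Int.gcd_natCast_natCast] using hcs.coprime_dvd_left (dvd_mul_right s s))
  rw [h2, h3]
  norm_num

theorem etaMult_of_dvd {a b : ℤ} {c d : ℕ} (hd : Odd d) (hb : 24 ∣ b) (had : 24 ∣ a - d) :
    etaMult a b c d = J((c : ℤ) | d) * e24 (3 * (d - 1) - c * d) := by
  rw [etaMult, if_pos hd]
  congr 1
  apply e24_congr
  obtain ⟨k, rfl⟩ := hb
  obtain ⟨l, hl⟩ := had
  obtain rfl : a = d + 24 * l := by linarith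
  exact ⟨l * c - k * d * (c ^ 2 - 1), by rw [etaExpo]; ring⟩

/-- Here ad ≡ 1 modulo 24, and every unit modulo 24 is its own inverse. -/
theorem dvd_sub_of_mul_sub {a b c d : ℤ} (hb : 24 ∣ b) (h : a * d - b * c = 1) :
    24 ∣ a - d := by
  apply dvd_24_of_zmod
  · have h8 := congrArg (Int.cast : ℤ → ZMod 8) h
    have hb8 : (b : ZMod 8) = 0 :=
      (ZMod.intCast_zmod_eq_zero_iff_dvd b 8).mpr (dvd_trans (by norm_num) hb)
    push_cast at h8 ⊢
    rw [hb8] at h8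
    generalize (a : ZMod 8) = a, (c : ZMod 8) = c, (d : ZMod 8) = d at *
    revert a c d; decide +kernel
  · have h8 := congrArg (Int.cast : ℤ → ZMod 3) h
    have hb8 : (b : ZMod 3) = 0 :=
      (ZMod.intCast_zmod_eq_zero_iff_dvd b 3).mpr (dvd_trans (by norm_num) hb)
    push_cast at h8 ⊢
    rw [hb8] at h8
    generalize (a : ZMod 3) = a, (c : ZMod 3) = c, (d : ZMod 3) = d at *
    revert a c d; decide +kernel

variable (d e N) in
/-- Numerical conditions under which `∏ η(dᵢ τ) ^ eᵢ` has weight four and level `N`. -/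
structure IsEtaQuotOfLevel : Prop where
  six_dvd : 6 ∣ N
  dvd : ∀ i, d i ∣ N
  sum_eq : ∑ i, e i = 8
  sum_mul : 24 ∣ ∑ i, (d i : ℤ) * e i
  sum_div_mul : 24 ∣ ∑ i, ((N / d i : ℕ) : ℤ) * e i
  even_sum : Even (∑ i, (e i).natAbs)
  isSquare : IsSquare (∏ i, d i ^ (e i).natAbs)

variable (d e) in
/-- The eta quotient `∏ η(dᵢ z) ^ eᵢ` as a function on `ℂ`. -/
noncomputable def etaProd (z : ℂ) : ℂ := ∏ i, η (d i * z) ^ e i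

namespace IsEtaQuotOfLevel

theorem etaProd_add_int (h : IsEtaQuotOfLevel d e N) (z : ℂ) (n : ℤ) :
    etaProd d e (z + n) = etaProd d e z := by
  have h1 (i : ι) : η (d i * (z + n)) ^ e i = e24 (n * (d i * e i)) * η (d i * z) ^ e i := by
    rw [show (d i : ℂ) * (z + n) = d i * z + ((d i * n : ℤ) : ℂ) by push_cast; ring, eta_add_int,
      mul_zpow, e24_zpow]
    congr 2
    ring
  simp_rw [etaProd, h1, Finset.prod_mul_distrib]
  rw [← e24_sum, ← Finset.mul_sum, e24_eq_one (h.sum_mul.mul_left n), one_mul]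

/-- Each factor transforms by `eta_mobius` with lower left entry c/dᵢ. The Jacobi symbols multiply
to 1; in the exponent of the root of unity, ∑ eᵢ = 8 turns 3(δ − 1) into 24(δ − 1), and
`sum_div_mul` handles the rest. Eight square roots give the fourth power. -/
theorem etaProd_mobius_of_dvd [∀ i, NeZero (d i)] (h : IsEtaQuotOfLevel d e N) {a b : ℤ} {c δ : ℕ} (hc : N ∣ c)
    (hb : 24 ∣ b) (hdet : a * δ - b * c = 1) {z : ℂ} (hz : 0 < z.im) :
    etaProd d e ((a * z + b) / (c * z + δ)) = (c * z + δ) ^ 4 * etaProd d e z := by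
  have h6 : 6 ∣ c := h.six_dvd.trans hc
  have hD : Odd δ := by
    rw [← Nat.not_even_iff_odd]
    rintro ⟨k, rfl⟩
    obtain ⟨l, rfl⟩ := h6
    push_cast at hdet
    have : 2 * (a * k - b * (3 * l)) = 1 := by linarith
    omega
  have hcop : Nat.Coprime c δ := by
    rw [Nat.coprime_iff_isRelPrime, ← Nat.coprime_iff_isRelPrime, ← Nat.isCoprime_iff_coprime]
    exact ⟨-b, a, by linarith⟩
  have had := dvd_sub_of_mul_sub hb hdet
  set q : ι → ℕ := fun i => c / d i
  have hq (i : ι) : q i * d i = c := Nat.div_mul_cancel ((h.dvd i).trans hc)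
  have h1 (i : ι) : η (d i * ((a * z + b) / (c * z + δ))) =
      J((q i : ℤ) | δ) * e24 (3 * (δ - 1) - q i * δ) * (c * z + δ) ^ (2⁻¹ : ℂ) * η (d i * z) := by
    have hz' : 0 < ((d i : ℂ) * z).im := by
      simpa using mul_pos (Nat.cast_pos.mpr (NeZero.pos (d i))) hz
    have hqi : (q i : ℂ) * (d i * z) = c * z := by rw [← mul_assoc, ← hq i]; push_cast; ring
    have := eta_mobius a (b * d i) (q i) δ (by rw [mul_assoc, ← Nat.cast_mul, mul_comm (d i), hq i,
      hdet]) hz'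
    rw [etaMult_of_dvd hD (hb.mul_right _) had, hqi] at this
    rw [← this]
    congr 1
    push_cast
    ring
  have hne : ((c : ℂ) * z + δ) ^ (2⁻¹ : ℂ) ≠ 0 := by
    have : (c : ℂ) * z + δ ≠ 0 := fun h0 => by
      have h1 := congrArg Complex.im h0
      have h2 := congrArg Complex.re h0
      have hδ : (δ : ℝ) ≠ 0 := by exact_mod_cast hD.pos.ne'
      simp [hz.ne'] at h1
      simp [h1] at h2
      exact hδ (by exact_mod_cast h2)
    simp [Complex.cpow_eq_zero_iff, this]
  simp_rw [etaProd, h1, mul_zpow, Finset.prod_mul_distrib, e24_zpow]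
  rw [prod_jacobiSym_zpow h.even_sum h.isSquare hq hcop, ← e24_sum, ← zpow_sum hne, h.sum_eq]
  have h2 : 24 ∣ ∑ i, e i * (3 * ((δ : ℤ) - 1) - q i * δ) := by
    simp_rw [mul_sub (_ : ℤ) (3 * ((δ : ℤ) - 1)), Finset.sum_sub_distrib, ← Finset.sum_mul,
      h.sum_eq]
    obtain ⟨k, rfl⟩ := hc
    have h3 : ∑ i, e i * (q i * (δ : ℤ)) = δ * k * ∑ i, ((N / d i : ℕ) : ℤ) * e i := by
      rw [Finset.mul_sum]
      refine Finset.sum_congr rfl fun i _ => ?_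
      have : q i = N / d i * k := by
        simp only [q]; rw [Nat.div_mul_right_comm (h.dvd i)]
      rw [this]; push_cast; ring
    rw [h3]
    refine dvd_sub ⟨(δ : ℤ) - 1, by ring⟩ (h.sum_div_mul.mul_left _)
  rw [e24_eq_one h2, one_mul, one_mul]
  congr 1
  rw [show (8 : ℤ) = ((2 * 4 : ℕ) : ℤ) by norm_num, zpow_natCast, pow_mul]
  simp

theorem etaProd_mobius_of_pos [∀ i, NeZero (d i)] (h : IsEtaQuotOfLevel d e N) {a b c δ : ℤ}
    (hc : (N : ℤ) ∣ c) (hb : 24 ∣ b) (hδ : 0 < δ) (hdet : a * δ - b * c = 1) {z : ℂ}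
    (hz : 0 < z.im) :
    etaProd d e ((a * z + b) / (c * z + δ)) = (c * z + δ) ^ 4 * etaProd d e z := by
  lift δ to ℕ using hδ.le
  obtain ⟨k, rfl⟩ := hc
  -- Right multiplication by (1 0; Nj 1) replaces c = Nk by N(k + δj), which is nonnegative for j =
  -- |k| since δ ≥ 1, and leaves b and δ alone.
  set j : ℕ := k.natAbs
  have hj : 0 ≤ k + δ * j := by
    have h1 : -k ≤ j := by simpa [j] using neg_abs_le k |> neg_le.mp
    nlinarith [Int.natCast_nonneg j]
  obtain ⟨l, hl⟩ := Int.eq_ofNat_of_zero_le hj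
  -- `w` is the preimage of `z` under `(1 0; N j 1)`
  set w : ℂ := z / (1 - N * j * z)
  have hden : (1 - N * j * z : ℂ) ≠ 0 := fun h0 => by
    have h1 := congrArg Complex.im h0
    have h2 := congrArg Complex.re h0
    simp at h1 h2
    rcases h1 with (h1 | h1) | h1
    · simp [h1] at h2
    · simp [h1] at h2
    · exact hz.ne' h1
  have hw : 0 < w.im := by
    have := im_mobius hz (a := 1) (b := 0) (c := -(N * j)) (d := 1) (by norm_num)
    convert this using 2
    simp only [w]
    push_cast
    ring_nf
  have hjw : (N * j * w + 1 : ℂ) * (1 - N * j * z) = 1 := by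
    simp only [w]; field_simp; ring
  have hjw0 : (N * j * w + 1 : ℂ) ≠ 0 := left_ne_zero_of_mul_eq_one hjw
  have hwz : w = z * (N * j * w + 1) := by
    apply mul_right_cancel₀ hden
    rw [mul_assoc z, hjw, mul_one]
    exact div_mul_cancel₀ _ hden
  have hz' : z = w / (N * j * w + 1) := by rw [eq_div_iff hjw0, ← hwz]
  have e1 := h.etaProd_mobius_of_dvd (a := 1) (b := 0) (c := N * j) (δ := 1) (dvd_mul_right _ _)
    (dvd_zero _) (by norm_num) hw
  have e2 := h.etaProd_mobius_of_dvd (a := a + b * (N * j)) (b := b) (c := N * l) (δ := δ)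
    (dvd_mul_right _ _) hb (by
      have : ((N * l : ℕ) : ℤ) = N * (k + δ * j) := by push_cast; rw [hl]
      rw [this]; linarith) hw
  have hl' : (l : ℂ) = k + δ * j := by
    have := congrArg (Int.cast : ℤ → ℂ) hl; push_cast at this; simpa using this.symm
  push_cast [hl'] at e1 e2 ⊢
  have hc1 : ((N : ℂ) * (k + δ * j) * w + δ) = (N * k * z + δ) * (N * j * w + 1) := by
    linear_combination (N : ℂ) * k * hwz
  have hc2 : ((a : ℂ) + b * (N * j)) * w + b = (a * z + b) * (N * j * w + 1) := by
    linear_combination (a : ℂ) * hwz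
  rw [hc1, hc2, mul_div_mul_right _ _ hjw0] at e2
  rw [one_mul, add_zero, ← hz'] at e1
  rw [e2, e1]
  ring

theorem etaProd_mobius [∀ i, NeZero (d i)] (h : IsEtaQuotOfLevel d e N) {a b c δ : ℤ}
    (hc : (N : ℤ) ∣ c) (hdet : a * δ - b * c = 1) {z : ℂ} (hz : 0 < z.im) :
    etaProd d e ((a * z + b) / (c * z + δ)) = (c * z + δ) ^ 4 * etaProd d e z := by
  have h6 : 6 ∣ c := (by exact_mod_cast h.six_dvd : (6 : ℤ) ∣ N).trans hc
  have hcop : IsCoprime δ 24 := by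
    have h2 : IsCoprime δ 6 := by
      obtain ⟨k, rfl⟩ := h6
      exact ⟨a, -b * k, by linarith⟩
    -- 24 divides 6³ = 24 · 9.
    have h3 := h2.pow_right (n := 3)
    exact h3.of_isCoprime_of_dvd_right ⟨9, by norm_num⟩
  obtain ⟨u, v, huv⟩ := hcop
  -- translate on the left by `j` to make the upper right entry divisible by 24
  set j : ℤ := -b * u
  have hb : 24 ∣ b + j * δ := ⟨b * v, by simp only [j]; linear_combination -b * huv⟩
  have hdet' : (a + j * c) * δ - (b + j * δ) * c = 1 := by linarith
  have hδ0 : δ ≠ 0 := by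
    rintro rfl
    obtain ⟨k, rfl⟩ := h6
    have : 6 * (-b * k) = 1 := by linarith
    omega
  have hden : (c * z + δ : ℂ) ≠ 0 := fun h0 => by
    have h1 := congrArg Complex.im h0
    have h2 := congrArg Complex.re h0
    simp [hz.ne'] at h1
    simp [h1] at h2
    exact hδ0 (by exact_mod_cast h2)
  have key : etaProd d e (((a + j * c : ℤ) * z + (b + j * δ : ℤ)) / (c * z + δ)) =
      (c * z + δ) ^ 4 * etaProd d e z := by
    -- A negative δ is reduced to a positive one by negating the matrix, which changes neither the
    -- action nor the fourth power.
    rcases lt_or_gt_of_ne hδ0 with hδ | hδ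
    · have := h.etaProd_mobius_of_pos (a := -(a + j * c)) (b := -(b + j * δ)) (c := -c) (δ := -δ)
        (hc.neg_right) (hb.neg_right) (by linarith) (by linarith) hz
      rw [← neg_div_neg_eq]
      push_cast at this ⊢
      convert this using 2
      · congr 1 <;> ring
      · ring
    · exact h.etaProd_mobius_of_pos hc hb hδ hdet' hz
  rw [← key, ← h.etaProd_add_int _ j]
  congr 1
  push_cast
  rw [div_add' _ _ _ hden]
  congr 1
  ring

end IsEtaQuotOfLevel

end EtaQuotient

/-! ### Behaviour at the cusps -/

/-- The action `z ↦ (A z + B) / E` of an upper triangular integral matrix. -/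
noncomputable def upperTri (A E : ℕ+) (B : ℤ) (z : ℍ) : ℍ :=
  ⟨(A * z + B) / E, by
    rw [← Complex.ofReal_natCast E, Complex.div_ofReal_im]
    simpa using z.im_pos⟩

theorem coe_upperTri (A E : ℕ+) (B : ℤ) (z : ℍ) :
    (upperTri A E B z : ℂ) = (A * z + B) / E := rfl

theorem im_upperTri (A E : ℕ+) (B : ℤ) (z : ℍ) : (upperTri A E B z).im = A / E * z.im := by
  change ((A * z + B : ℂ) / E).im = _
  rw [← Complex.ofReal_natCast E, Complex.div_ofReal_im]
  simp
  ring

theorem tendsto_upperTri (A E : ℕ+) (B : ℤ) : Tendsto (upperTri A E B) atImInfty atImInfty := by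
  rw [atImInfty, tendsto_comap_iff]
  have : UpperHalfPlane.im ∘ upperTri A E B = fun z => (A / E : ℝ) * z.im := by
    ext z; simp [im_upperTri]
  rw [this]
  exact tendsto_comap.const_mul_atTop (by positivity)

/-- Decomposition of `(r 0; 0 1) γ` as a unimodular times an upper triangular matrix. -/
theorem exists_upperTri (γ : SL(2, ℤ)) (r : ℕ) [NeZero r] :
    ∃ (γ' : SL(2, ℤ)) (A E : ℕ+) (B : ℤ), (A * E : ℕ) = r ∧ (A : ℕ) = Int.gcd (γ 1 0) r ∧
      γ' 1 0 * A = γ 1 0 ∧ ∀ z : ℍ, scaleH r (γ • z) = γ' • upperTri A E B z ∧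
        denom γ z = E * denom γ' (upperTri A E B z) := by
  set a := γ 0 0
  set b := γ 0 1
  set c := γ 1 0
  set d := γ 1 1
  have hdet : a * d - b * c = 1 := by rw [← Matrix.det_fin_two, γ.det_coe]
  have hr : 0 < r := NeZero.pos r
  set A := Int.gcd c r
  have hA : 0 < A := Int.gcd_pos_of_ne_zero_right _ (by exact_mod_cast hr.ne')
  obtain ⟨E, hE⟩ : A ∣ r := by exact_mod_cast Int.gcd_dvd_right c r
  obtain ⟨c', hc'⟩ : (A : ℤ) ∣ c := Int.gcd_dvd_left c r
  have hE0 : 0 < E := Nat.pos_of_ne_zero fun h => by simp [h] at hE; omega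
  have hE' : (r : ℤ) = A * E := by exact_mod_cast hE
  have hcE : IsCoprime c' (E : ℤ) := by
    obtain ⟨x, y, hxy⟩ : ∃ x y, (A : ℤ) = c * x + r * y := ⟨_, _, Int.gcd_eq_gcd_ab c r⟩
    have hA' : (A : ℤ) ≠ 0 := by exact_mod_cast hA.ne'
    refine ⟨x, y, mul_left_cancel₀ hA' ?_⟩
    linear_combination -x * hc' - y * hE' - hxy
  have hac : IsCoprime a c' := ⟨d, -b * A, by linear_combination hdet + b * hc'⟩
  -- The first column of (r 0; 0 1)γ is A times the primitive vector (aE, c'). Bézout coefficients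
  -- complete this vector to γ', and B is the upper entry of γ'⁻¹ applied to the second column (rb,
  -- d).
  obtain ⟨d0, b0, h0⟩ : IsCoprime (a * E) c' := hac.mul_left hcE.symm
  set B := d0 * r * b + b0 * d
  have e1 : r * b = a * E * B + -b0 * E := by
    linear_combination -r * b * h0 - b0 * E * hdet + b0 * b * c' * hE' - b0 * b * E * hc'
  have e2 : d = c' * B + d0 * E := by
    linear_combination -d * h0 + d0 * E * hdet - d0 * b * c' * hE' + d0 * b * E * hc'
  obtain ⟨γ', h00, h01, h10, h11⟩ : ∃ γ' : SL(2, ℤ), γ' 0 0 = a * E ∧ γ' 0 1 = -b0 ∧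
      γ' 1 0 = c' ∧ γ' 1 1 = d0 :=
    ⟨⟨!![a * E, -b0; c', d0], by rw [Matrix.det_fin_two_of]; linarith⟩, rfl, rfl, rfl, rfl⟩
  obtain ⟨A', hA'⟩ : ∃ A' : ℕ+, (A' : ℕ) = A := ⟨⟨A, hA⟩, rfl⟩
  obtain ⟨E', hE''⟩ : ∃ E' : ℕ+, (E' : ℕ) = E := ⟨⟨E, hE0⟩, rfl⟩
  refine ⟨γ', A', E', B, by rw [hA', hE'', hE], hA', by rw [h10, hA', hc', mul_comm],
    fun z => ?_⟩
  have hE0' : (E : ℂ) ≠ 0 := by exact_mod_cast hE0.ne'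
  have e1' := congrArg (Int.cast : ℤ → ℂ) e1
  have e2' := congrArg (Int.cast : ℤ → ℂ) e2
  have e3' := congrArg (Int.cast : ℤ → ℂ) hE'
  have e4' := congrArg (Int.cast : ℤ → ℂ) hc'
  push_cast at e1' e2' e3' e4'
  have hden : (c * z + d : ℂ) = E * (c' * ((A * z + B) / E) + d0) := by
    field_simp
    linear_combination e2' + z * e4'
  constructor
  · ext
    rw [coe_scaleH, coe_specialLinearGroup_apply, coe_specialLinearGroup_apply, coe_upperTri, hA', hE'', h00,
      h01, h10, h11]
    simp only [algebraMap_int_eq, eq_intCast, Complex.ofReal_intCast]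
    change (r : ℂ) * ((a * z + b) / (c * z + d)) = _
    rw [hden, ← mul_div_mul_left _ (_ + _ : ℂ) hE0', ← mul_div_assoc]
    congr 1
    push_cast
    field_simp
    linear_combination e1' + z * a * e3'
  · rw [ModularGroup.denom_apply, ModularGroup.denom_apply, coe_upperTri, hA', hE'', h10, h11]
    exact hden

/-- The 24th power is the discriminant, so no root of unity enters. With w = (Az + B)/E one has Im w
= (A²/r) Im z for A = gcd(c, r), which gives the exponential; the Euler product at w tends to 1. -/
theorem eta_scale_smul (γ : SL(2, ℤ)) (r : ℕ) [NeZero r] :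
    ∃ (u : ℍ → ℝ) (C : ℝ), 0 < C ∧ Tendsto u atImInfty (𝓝 C) ∧ ∀ z : ℍ,
      ‖η (r * (γ • z : ℍ))‖ ^ 24 = ‖denom γ z‖ ^ 12 *
        Real.exp (-(2 * Real.pi * z.im) * (Int.gcd (γ 1 0) r ^ 2 / r)) * u z := by
  obtain ⟨γ', A, E, B, hr, hA, -, hz⟩ := exists_upperTri γ r
  refine ⟨fun z => (E : ℝ)⁻¹ ^ 12 * ‖eulerH (upperTri A E B z)‖ ^ 24, (E : ℝ)⁻¹ ^ 12 * ‖(1 : ℂ)‖ ^ 24,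
    by simp, ((tendsto_eulerH.comp (tendsto_upperTri A E B)).norm.pow 24).const_mul _,
    fun z => ?_⟩
  obtain ⟨h1, h2⟩ := hz z
  set w := upperTri A E B z
  have h3 : η (γ' • w : ℍ) ^ 24 = denom γ' w ^ 12 * η w ^ 24 := by
    have h := congrFun (SlashInvariantForm.slash_action_generators_SL2Z ModularForm.discriminant_S_invariant
      ModularForm.discriminant_T_invariant γ') w
    rw [ModularForm.SL_slash_apply, ModularForm.discriminant, ModularForm.discriminant,
      zpow_neg, ← div_eq_mul_inv, div_eq_iff (zpow_ne_zero _ (denom_ne_zero _ _))] at h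
    rw [h, mul_comm]
    norm_cast
  rw [← coe_scaleH, h1, ← norm_pow, h3, h2, eta_eq_eulerH, norm_mul, norm_mul, norm_pow, norm_pow,
    norm_mul, mul_pow, mul_pow]
  have h4 : ‖Periodic.qParam 24 (w : ℂ)‖ ^ 24 =
      Real.exp (-(2 * Real.pi * z.im) * (Int.gcd (γ 1 0) r ^ 2 / r)) := by
    rw [Periodic.norm_qParam, ← Real.exp_nat_mul]
    congr 1
    rw [← hA, ← hr]
    have : (w : ℂ).im = A / E * z.im := im_upperTri A E B z
    rw [this]
    push_cast
    field_simp
  rw [h4]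
  simp
  field_simp
  rfl

/-- A function on the upper half-plane that is a modular form of weight `k` for `Γ₀(N)`. -/
structure IsModularOn (N : ℕ) (k : ℤ) (f : ℍ → ℂ) : Prop where
  mdiff : MDiff f
  slash_eq : ∀ γ : SL(2, ℤ), (N : ℤ) ∣ γ 1 0 → f ∣[k] γ = f
  bounded : ∀ γ : SL(2, ℤ), IsBoundedAtImInfty (f ∣[k] γ)

namespace IsModularOn

variable {N : ℕ} {k : ℤ} {f g : ℍ → ℂ}

theorem add (hf : IsModularOn N k f) (hg : IsModularOn N k g) : IsModularOn N k (f + g) where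
  mdiff := hf.mdiff.add hg.mdiff
  slash_eq γ hγ := by rw [SlashAction.add_slash, hf.slash_eq γ hγ, hg.slash_eq γ hγ]
  bounded γ := by rw [SlashAction.add_slash]; exact (hf.bounded γ).add (hg.bounded γ)

theorem smul (hf : IsModularOn N k f) (c : ℂ) : IsModularOn N k (c • f) where
  mdiff := hf.mdiff.const_smul c
  slash_eq γ hγ := by rw [ModularForm.SL_smul_slash, hf.slash_eq γ hγ]
  bounded γ := by
    rw [ModularForm.SL_smul_slash]
    exact (hf.bounded γ).const_smul_left c

theorem sub (hf : IsModularOn N k f) (hg : IsModularOn N k g) : IsModularOn N k (f - g) := by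
  have := hf.add (hg.smul (-1))
  rwa [neg_one_smul, ← sub_eq_add_neg] at this

theorem sum {ι : Type*} [Nonempty ι] (s : Finset ι) {f : ι → ℍ → ℂ}
    (h : ∀ i, IsModularOn N k (f i)) : IsModularOn N k (∑ i ∈ s, f i) := by
  classical
  induction s using Finset.induction_on with
  | empty =>
    obtain ⟨i⟩ := ‹Nonempty ι›
    simpa using (h i).smul 0
  | insert i s hi ih => rw [Finset.sum_insert hi]; exact (h i).add ih

end IsModularOn

section EtaQuotient

variable {ι : Type*} [Fintype ι] {d : ι → ℕ} [∀ i, NeZero (d i)] {e : ι → ℤ} {N : ℕ}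

theorem IsEtaQuotOfLevel.slash_etaQuot (h : IsEtaQuotOfLevel d e N) (γ : SL(2, ℤ))
    (hγ : (N : ℤ) ∣ γ 1 0) : etaQuot d e ∣[(4 : ℤ)] γ = etaQuot d e := by
  ext z
  have hdet : γ 0 0 * γ 1 1 - γ 0 1 * γ 1 0 = 1 := by rw [← Matrix.det_fin_two, γ.det_coe]
  have h1 := h.etaProd_mobius hγ hdet z.im_pos
  rw [ModularForm.SL_slash_apply, zpow_neg, ← div_eq_mul_inv,
    div_eq_iff (zpow_ne_zero _ (denom_ne_zero _ _)), ModularGroup.denom_apply]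
  change etaProd d e (γ • z : ℍ) = etaProd d e z * _
  rw [coe_specialLinearGroup_apply]
  simp only [algebraMap_int_eq, eq_intCast, Complex.ofReal_intCast]
  rw [h1, mul_comm]
  norm_cast

/-- The order of vanishing of the eta quotient at each cusp is nonnegative. -/
theorem IsEtaQuotOfLevel.isBounded (h : IsEtaQuotOfLevel d e N)
    (hord : ∀ g ∈ N.divisors, 0 ≤ ∑ i, e i * (Nat.gcd g (d i) ^ 2 * (N / d i) : ℕ)) (hN : N ≠ 0)
    (γ : SL(2, ℤ)) : IsBoundedAtImInfty (etaQuot d e ∣[(4 : ℤ)] γ) := by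
  choose u C hC hu hη using fun i => eta_scale_smul γ (d i)
  have hS : 0 ≤ ∑ i, (e i : ℝ) * (Int.gcd (γ 1 0) (d i) ^ 2 / d i) := by
    have h1 := hord (Int.gcd (γ 1 0) N) (by
      simpa [hN] using (by exact_mod_cast Int.gcd_dvd_right (γ 1 0) N : Int.gcd (γ 1 0) N ∣ N))
    have h2 : ∑ i, (e i : ℝ) * (Int.gcd (γ 1 0) (d i) ^ 2 / d i) = (N : ℝ)⁻¹ *
        ((∑ i, e i * (Nat.gcd (Int.gcd (γ 1 0) N) (d i) ^ 2 * (N / d i) : ℕ) : ℤ) : ℝ) := by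
      rw [Int.cast_sum, Finset.mul_sum]
      refine Finset.sum_congr rfl fun i _ => ?_
      have hg : Nat.gcd (Int.gcd (γ 1 0) N) (d i) = Int.gcd (γ 1 0) (d i) := by
        simp only [Int.gcd, Int.natAbs_natCast]
        rw [Nat.gcd_assoc, Nat.gcd_eq_right (h.dvd i)]
      have hd0 : (d i : ℝ) ≠ 0 := by exact_mod_cast NeZero.ne (d i)
      have hN0 : (N : ℝ) ≠ 0 := by exact_mod_cast hN
      rw [Int.cast_mul, Int.cast_natCast, Nat.cast_mul, Nat.cast_pow, hg,
        Nat.cast_div (h.dvd i) hd0]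
      field_simp
    rw [h2]
    exact mul_nonneg (by positivity) (by exact_mod_cast h1)
  have hprod : Tendsto (fun z => ∏ i, u i z ^ e i) atImInfty (𝓝 (∏ i, C i ^ e i)) :=
    tendsto_finsetProd _ fun i _ => (hu i).zpow₀ (e i) (Or.inl (hC i).ne')
  have hpow (z : ℍ) : ‖(etaQuot d e ∣[(4 : ℤ)] γ) z‖ ^ 24 =
      Real.exp (-(2 * Real.pi * z.im) * ∑ i, (e i : ℝ) * (Int.gcd (γ 1 0) (d i) ^ 2 / d i)) *
        ∏ i, u i z ^ e i := by
    have hden : ‖denom γ z‖ ≠ 0 := norm_ne_zero_iff.mpr (denom_ne_zero _ _)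
    rw [ModularForm.SL_slash_apply, etaQuot, norm_mul, norm_prod, mul_pow, ← Finset.prod_pow]
    have h1 (i : ι) : ‖η (d i * (γ • z : ℍ)) ^ e i‖ ^ 24 = (‖denom γ z‖ ^ 12) ^ e i *
        Real.exp (-(2 * Real.pi * z.im) * ((e i : ℝ) * (Int.gcd (γ 1 0) (d i) ^ 2 / d i))) *
          u i z ^ e i := by
      rw [norm_zpow, ← zpow_natCast, ← zpow_mul, mul_comm (e i), zpow_mul, zpow_natCast, hη, mul_zpow,
        mul_zpow, ← Real.rpow_intCast (Real.exp _), ← Real.exp_mul]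
      congr 3
      ring
    simp_rw [h1, Finset.prod_mul_distrib]
    rw [← Real.exp_sum, ← Finset.mul_sum]
    -- 12 ∑ eᵢ = 96 = 4 · 24, exactly what the 24th power of the weight 4 factor cancels.
    have h2 : ∏ i, (‖denom γ z‖ ^ 12) ^ e i = ‖denom γ z‖ ^ 96 := by
      have := zpow_sum (x := ((‖denom γ z‖ ^ 12 : ℝ) : ℂ)) (by exact_mod_cast pow_ne_zero _ hden)
        Finset.univ e
      rw [h.sum_eq] at this
      have h3 : ∏ i, (‖denom γ z‖ ^ 12) ^ e i = (‖denom γ z‖ ^ 12) ^ (8 : ℤ) := by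
        exact_mod_cast this.symm
      rw [h3]
      norm_cast
      rw [← pow_mul]
    rw [h2, norm_zpow, ← zpow_natCast (_ ^ (-4 : ℤ)) 24, ← zpow_mul, ← zpow_natCast _ 96]
    have h3 : ‖denom γ z‖ ^ ((96 : ℕ) : ℤ) * ‖denom γ z‖ ^ (-4 * ((24 : ℕ) : ℤ)) = 1 := by
      rw [← zpow_add₀ hden]; norm_num
    linear_combination (Real.exp (-(2 * Real.pi * z.im) * ∑ i, (e i : ℝ) *
      (Int.gcd (γ 1 0) (d i) ^ 2 / d i)) * ∏ i, u i z ^ e i) * h3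
  rw [isBoundedAtImInfty_iff]
  have hM := hprod.eventually (eventually_le_nhds (lt_add_one (∏ i, C i ^ e i)))
  obtain ⟨A, hA⟩ := (atImInfty_mem _).mp hM
  set M := ∏ i, C i ^ e i + 1
  have hM0 : 0 ≤ M := by
    have : 0 ≤ ∏ i, C i ^ e i := Finset.prod_nonneg fun i _ => zpow_nonneg (hC i).le _
    positivity
  refine ⟨1 + M, A, fun z hz => ?_⟩
  have h1 : ∏ i, u i z ^ e i ≤ M := hA z hz
  have h2 : ‖(etaQuot d e ∣[(4 : ℤ)] γ) z‖ ^ 24 ≤ M := by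
    rw [hpow]
    refine (mul_le_mul_of_nonneg_left h1 (Real.exp_pos _).le).trans ?_
    refine mul_le_of_le_one_left hM0 (Real.exp_le_one_iff.mpr ?_)
    have := mul_nonneg (mul_nonneg Real.two_pi_pos.le z.im_pos.le) hS
    linarith
  rcases le_or_gt ‖(etaQuot d e ∣[(4 : ℤ)] γ) z‖ 1 with h3 | h3
  · linarith
  · have := le_self_pow₀ h3.le (n := 24) (by norm_num)
    linarith

theorem IsEtaQuotOfLevel.isModularOn (h : IsEtaQuotOfLevel d e N)
    (hord : ∀ g ∈ N.divisors, 0 ≤ ∑ i, e i * (Nat.gcd g (d i) ^ 2 * (N / d i) : ℕ)) (hN : N ≠ 0) :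
    IsModularOn N 4 (etaQuot d e) where
  mdiff := mdiff_etaQuot d e
  slash_eq := h.slash_etaQuot
  bounded := h.isBounded hord hN

end EtaQuotient

/-! ### Eisenstein series of level N -/

theorem HasQExp.upperTri_one {f : ℍ → ℂ} {p : PowerSeries ℂ} (hf : HasQExp f p) {A E : ℕ+} (B : ℤ)
    {r : ℕ} [NeZero r] (hE : E = 1) (hA : (A : ℕ) = r) (z : ℍ) :
    f (upperTri A E B z) = f (scaleH r z) := by
  refine (hf _).unique ?_
  convert hf (scaleH r z) using 3 with n
  congr 1
  rw [coe_upperTri, coe_scaleH, hE, hA]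
  simp only [Periodic.qParam]
  rw [Complex.exp_eq_exp_iff_exists_int]
  exact ⟨B, by push_cast; ring⟩

theorem eq_one_of_gcd_eq {A E : ℕ+} {r : ℕ} {c : ℤ} (h1 : (A * E : ℕ) = r)
    (h2 : (A : ℕ) = Int.gcd c r) (h : (r : ℤ) ∣ c) : E = 1 ∧ (A : ℕ) = r := by
  have h3 : (A : ℕ) = r := by
    rw [h2]
    exact Nat.gcd_eq_right (Int.natCast_dvd.mp h)
  refine ⟨?_, h3⟩
  rw [h3] at h1
  have hr : 0 < r := h3 ▸ A.pos
  have : (E : ℕ) = 1 := by nlinarith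
  exact_mod_cast this

theorem E₄_scale_slash (r : ℕ) [NeZero r] (γ : SL(2, ℤ)) : ∃ (A E : ℕ+) (B : ℤ), (A * E : ℕ) = r ∧
    (A : ℕ) = Int.gcd (γ 1 0) r ∧ (fun z => ModularForm.E₄ (scaleH r z)) ∣[(4 : ℤ)] γ =
      fun z => (E : ℂ)⁻¹ ^ 4 * ModularForm.E₄ (upperTri A E B z) := by
  obtain ⟨γ', A, E, B, hr, hA, -, hz⟩ := exists_upperTri γ r
  refine ⟨A, E, B, hr, hA, ?_⟩
  ext z
  obtain ⟨h1, h2⟩ := hz z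
  have h3 := congrFun (ModularForm.E₄.slash_action_eq' _ ⟨γ', rfl⟩) (upperTri A E B z)
  have h4 : ((ModularForm.E₄ : ℍ → ℂ) ∣[(4 : ℤ)] γ') (upperTri A E B z) =
    ModularForm.E₄ (upperTri A E B z) := h3
  have hE : (E : ℂ) ≠ 0 := by exact_mod_cast E.pos.ne'
  rw [ModularForm.SL_slash_apply] at h4 ⊢
  rw [h1, h2, ← h4, mul_zpow, zpow_neg (E : ℂ), inv_pow]
  norm_cast
  ring

theorem isModularOn_E₄_scale {N : ℕ} (r : ℕ) [NeZero r] (hr : r ∣ N) :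
    IsModularOn N 4 (fun z => ModularForm.E₄ (scaleH r z)) where
  mdiff := mdiff_comp_scaleH ModularForm.E₄.holo' r
  slash_eq γ hγ := by
    obtain ⟨A, E, B, h1, h2, h3⟩ := E₄_scale_slash r γ
    obtain ⟨hE, hA⟩ := eq_one_of_gcd_eq h1 h2 ((Int.natCast_dvd_natCast.mpr hr).trans hγ)
    rw [h3]
    ext z
    rw [hasQExp_E₄.upperTri_one B hE hA z, hE]
    simp
  bounded γ := by
    obtain ⟨A, E, B, -, -, h3⟩ := E₄_scale_slash r γ
    rw [h3]
    exact (hasQExp_E₄.isBoundedAtImInfty.comp_tendsto (tendsto_upperTri A E B)).const_mul_left _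

/-- The form `r E₂(r z) - s E₂(s z)`. -/
noncomputable def eisDiff (r s : ℕ) [NeZero r] [NeZero s] : ℍ → ℂ :=
  (r : ℂ) • (fun z => E2 (scaleH r z)) - (s : ℂ) • fun z => E2 (scaleH s z)

/-- The relations AE = r and c'A = c make the correction term independent of r, so it disappears
from differences such as `eisDiff`. -/
theorem E2_scale_slash (r : ℕ) [NeZero r] (γ : SL(2, ℤ)) : ∃ (A E : ℕ+) (B : ℤ), (A * E : ℕ) = r ∧
    (A : ℕ) = Int.gcd (γ 1 0) r ∧ ∀ z, ((r : ℂ) • (fun z => E2 (scaleH r z)) ∣[(2 : ℤ)] γ) z =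
      r * (E : ℂ)⁻¹ ^ 2 * E2 (upperTri A E B z) - 1 / (2 * riemannZeta 2) * D2 γ z := by
  obtain ⟨γ', A, E, B, hr, hA, hc, hz⟩ := exists_upperTri γ r
  refine ⟨A, E, B, hr, hA, fun z => ?_⟩
  obtain ⟨h1, h2⟩ := hz z
  have h3 := congrFun (E2_slash_action γ') (upperTri A E B z)
  have hE : (E : ℂ) ≠ 0 := by exact_mod_cast E.pos.ne'
  have hd := denom_ne_zero γ' (upperTri A E B z)
  simp only [Pi.sub_apply, Pi.smul_apply, smul_eq_mul] at h3
  have h4 : E2 (upperTri A E B z) = (E2 ∣[(2 : ℤ)] γ') (upperTri A E B z) +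
    1 / (2 * riemannZeta 2) * D2 γ' (upperTri A E B z) := by rw [h3]; ring
  rw [Pi.smul_apply, ModularForm.SL_slash_apply, h4, ModularForm.SL_slash_apply, h1, D2, D2, h2, ← hc,
    ← hr, mul_zpow, zpow_neg (E : ℂ), inv_pow, smul_eq_mul]
  push_cast
  rw [show (E : ℂ) ^ (2 : ℤ) = E ^ 2 by norm_cast]
  generalize denom γ' (upperTri A E B z) ^ (-2 : ℤ) = j
  generalize 1 / (2 * riemannZeta 2) = κ
  field_simp
  ring

theorem eisDiff_slash (r s : ℕ) [NeZero r] [NeZero s] (γ : SL(2, ℤ)) :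
    ∃ (A E A' E' : ℕ+) (B B' : ℤ), (A * E : ℕ) = r ∧ (A : ℕ) = Int.gcd (γ 1 0) r ∧
      (A' * E' : ℕ) = s ∧ (A' : ℕ) = Int.gcd (γ 1 0) s ∧ eisDiff r s ∣[(2 : ℤ)] γ =
        fun z => r * (E : ℂ)⁻¹ ^ 2 * E2 (upperTri A E B z) -
          s * (E' : ℂ)⁻¹ ^ 2 * E2 (upperTri A' E' B' z) := by
  obtain ⟨A, E, B, h1, h2, h3⟩ := E2_scale_slash r γ
  obtain ⟨A', E', B', h1', h2', h3'⟩ := E2_scale_slash s γ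
  refine ⟨A, E, A', E', B, B', h1, h2, h1', h2', ?_⟩
  ext z
  rw [eisDiff, sub_eq_add_neg, SlashAction.add_slash, SlashAction.neg_slash,
    ModularForm.SL_smul_slash, ModularForm.SL_smul_slash, Pi.add_apply, Pi.neg_apply, h3, h3']
  ring

theorem isModularOn_eisDiff_sq {N : ℕ} (r s : ℕ) [NeZero r] [NeZero s] (hr : r ∣ N) (hs : s ∣ N) :
    IsModularOn N 4 (eisDiff r s * eisDiff r s) where
  mdiff := by
    have : MDiff (eisDiff r s) := ((mdiff_comp_scaleH E2_mdifferentiable r).const_smul _).sub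
      ((mdiff_comp_scaleH E2_mdifferentiable s).const_smul _)
    exact this.mul this
  slash_eq γ hγ := by
    have := ModularForm.mul_slash_SL2 2 2 γ (eisDiff r s) (eisDiff r s)
    norm_num at this
    obtain ⟨A, E, A', E', B, B', h1, h2, h1', h2', h3⟩ := eisDiff_slash r s γ
    obtain ⟨hE, hA⟩ := eq_one_of_gcd_eq h1 h2 ((Int.natCast_dvd_natCast.mpr hr).trans hγ)
    obtain ⟨hE', hA'⟩ := eq_one_of_gcd_eq h1' h2' ((Int.natCast_dvd_natCast.mpr hs).trans hγ)
    rw [this, h3]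
    have h4 : (fun z => r * (E : ℂ)⁻¹ ^ 2 * E2 (upperTri A E B z) -
          s * (E' : ℂ)⁻¹ ^ 2 * E2 (upperTri A' E' B' z)) = eisDiff r s := by
      ext z
      rw [hasQExp_E2.upperTri_one B hE hA z, hasQExp_E2.upperTri_one B' hE' hA' z, hE, hE', eisDiff]
      simp
    rw [h4]
  bounded γ := by
    have := ModularForm.mul_slash_SL2 2 2 γ (eisDiff r s) (eisDiff r s)
    norm_num at this
    obtain ⟨A, E, A', E', B, B', h1, h2, h1', h2', h3⟩ := eisDiff_slash r s γ
    have h4 : IsBoundedAtImInfty (eisDiff r s ∣[(2 : ℤ)] γ) := by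
      rw [h3]
      exact ((hasQExp_E2.isBoundedAtImInfty.comp_tendsto (tendsto_upperTri A E B)).const_mul_left _).sub
        ((hasQExp_E2.isBoundedAtImInfty.comp_tendsto (tendsto_upperTri A' E' B')).const_mul_left _)
    rw [this]
    exact h4.mul h4

/-! ### The index of Γ₀(42) and the Sturm bound -/

theorem index_Gamma0_prime_le (p : ℕ) [Fact p.Prime] :
    (CongruenceSubgroup.Gamma0 p).index ≤ p + 1 := by
  classical
  -- The first column modulo p as a point of the projective line, `none` being infinity. Matrices
  -- with the same point lie in the same left coset.
  set F : SL(2, ℤ) → Option (ZMod p) := fun g =>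
    if (g 0 0 : ZMod p) = 0 then none else some ((g 1 0 : ZMod p) / (g 0 0 : ZMod p)) with hF
  have key (g g' : SL(2, ℤ)) (h : F g = F g') : g⁻¹ * g' ∈ CongruenceSubgroup.Gamma0 p := by
    have h10 : (g⁻¹ * g') 1 0 = -(g 1 0) * g' 0 0 + g 0 0 * g' 1 0 := by
      rw [Matrix.SpecialLinearGroup.coe_mul, Matrix.mul_apply, Fin.sum_univ_two,
        Matrix.SpecialLinearGroup.SL2_inv_expl]
      simp
    rw [CongruenceSubgroup.Gamma0_mem, h10]
    push_cast
    simp only [hF] at h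
    split_ifs at h with h1 h2 h2
    · rw [h1, h2]; ring
    · rw [Option.some_inj, div_eq_div_iff h1 h2] at h
      linear_combination -h
  have hinj : Injective fun x : SL(2, ℤ) ⧸ CongruenceSubgroup.Gamma0 p => F x.out := fun x y h => by
    rw [← x.out_eq', ← y.out_eq']
    exact QuotientGroup.eq.mpr (key _ _ h)
  calc (CongruenceSubgroup.Gamma0 p).index ≤ Nat.card (Option (ZMod p)) :=
        Nat.card_le_card_of_injective _ hinj
    _ = p + 1 := by simp

/-- Γ₀(42) is the intersection of Γ₀(2), Γ₀(3) and Γ₀(7); an upper bound 3 · 4 · 8 is enough for the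
Sturm argument. -/
theorem index_Gamma0_42_le : (CongruenceSubgroup.Gamma0 42).index ≤ 96 := by
  have : Fact (Nat.Prime 7) := ⟨by norm_num⟩
  have h : CongruenceSubgroup.Gamma0 42 = CongruenceSubgroup.Gamma0 2 ⊓
      (CongruenceSubgroup.Gamma0 3 ⊓ CongruenceSubgroup.Gamma0 7) := by
    ext γ
    simp only [Subgroup.mem_inf, CongruenceSubgroup.Gamma0_mem, ZMod.intCast_zmod_eq_zero_iff_dvd]
    push_cast
    omega
  rw [h]
  calc _ ≤ _ := Subgroup.index_inf_le
    _ ≤ 3 * (4 * 8) := Nat.mul_le_mul (index_Gamma0_prime_le 2) (Subgroup.index_inf_le.trans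
        (Nat.mul_le_mul (index_Gamma0_prime_le 3) (index_Gamma0_prime_le 7)))

theorem card_quotient_Gamma0 (N : ℕ) : Nat.card (𝒮ℒ ⧸ ((CongruenceSubgroup.Gamma0 N).map
    (Matrix.SpecialLinearGroup.mapGL ℝ)).subgroupOf 𝒮ℒ) = (CongruenceSubgroup.Gamma0 N).index := by
  have := Subgroup.relIndex_map_map_of_injective (CongruenceSubgroup.Gamma0 N) ⊤
    (Matrix.SpecialLinearGroup.mapGL_injective (n := Fin 2) (R := ℤ) (S := ℝ))
  rw [← MonoidHom.range_eq_map, Subgroup.relIndex_top_right] at this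
  exact this

/-- The bundled modular form attached to a function that is modular on `Γ₀(N)`. -/
noncomputable def IsModularOn.toModularForm {N : ℕ} [NeZero N] {k : ℤ} {f : ℍ → ℂ}
    (hf : IsModularOn N k f) :
    ModularForm ((CongruenceSubgroup.Gamma0 N).map (Matrix.SpecialLinearGroup.mapGL ℝ)) k where
  toFun := f
  slash_action_eq' := by
    rintro _ ⟨γ, hγ, rfl⟩
    refine hf.slash_eq γ ?_
    exact (ZMod.intCast_zmod_eq_zero_iff_dvd _ _).mp (CongruenceSubgroup.Gamma0_mem.mp hγ)
  holo' := hf.mdiff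
  bdd_at_cusps' {c} hc := by
    rw [Subgroup.IsArithmetic.isCusp_iff_isCusp_SL2Z] at hc
    rw [OnePoint.isBoundedAt_iff_forall_SL2Z hc]
    exact fun γ _ => hf.bounded γ

/-- Vanishing to order m is recast as divisibility by qᵐ with bounded quotient. This form survives
multiplication by the other conjugates in the norm, which need not have expansions in integral
powers of q. -/
theorem HasQExp.eq_qParam_pow_mul {f : ℍ → ℂ} {p : PowerSeries ℂ} (hf : HasQExp f p) {m : ℕ}
    (h : ∀ n < m, p.coeff n = 0) : ∃ g : ℍ → ℂ, IsBoundedAtImInfty g ∧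
      ∀ τ, f τ = Periodic.qParam 1 τ ^ m * g τ := by
  have hg : HasQExp (fun τ => f τ / Periodic.qParam 1 τ ^ m)
      (PowerSeries.mk fun n => p.coeff (n + m)) := fun τ => by
    have h1 := (hasSum_nat_add_iff' m).mpr (hf τ)
    rw [Finset.sum_eq_zero fun i hi => by rw [h i (Finset.mem_range.mp hi), zero_mul], sub_zero] at h1
    have h2 := h1.div_const (Periodic.qParam 1 τ ^ m)
    have hq : Periodic.qParam 1 (τ : ℂ) ≠ 0 := Periodic.qParam_ne_zero _
    convert! h2 using 2 with n
    rw [PowerSeries.coeff_mk, pow_add]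
    field_simp
  refine ⟨_, hg.isBoundedAtImInfty, fun τ => ?_⟩
  have hq : Periodic.qParam 1 (τ : ℂ) ≠ 0 := Periodic.qParam_ne_zero _
  field_simp

theorem mdiff_qParam : MDiff (fun τ : ℍ => Periodic.qParam 1 (τ : ℂ)) := by
  rw [UpperHalfPlane.mdifferentiable_iff]
  have : DifferentiableOn ℂ (Periodic.qParam 1) {z : ℂ | 0 < z.im} := by
    unfold Periodic.qParam; fun_prop
  refine this.congr fun z hz => ?_
  simp [ofComplex_apply_of_im_pos hz]

/-- The quotient inherits holomorphy and periodicity, so boundedness already gives it a q-expansion.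
-/
theorem HasQExp.coeff_eq_zero {f : ℍ → ℂ} {p : PowerSeries ℂ} (hf : HasQExp f p) (hd : MDiff f)
    {m : ℕ} {g : ℍ → ℂ} (hg : IsBoundedAtImInfty g)
    (h : ∀ τ, f τ = Periodic.qParam 1 τ ^ m * g τ) {n : ℕ} (hn : n < m) : p.coeff n = 0 := by
  have hq (τ : ℍ) : Periodic.qParam 1 (τ : ℂ) ≠ 0 := Periodic.qParam_ne_zero _
  have h1 : g = f * (fun τ : ℍ => Periodic.qParam 1 (τ : ℂ) ^ m)⁻¹ := by
    ext τ
    have := hq τ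
    simp only [Pi.mul_apply, Pi.inv_apply, h]
    field_simp
  have hdg : MDiff g := by
    rw [h1]
    exact hd.mul ((mdiff_qParam.pow m).inv fun τ => pow_ne_zero _ (hq τ))
  have hper : Periodic (g ∘ ofComplex) ((1 : ℝ) : ℂ) := fun w => by
    have h2 := hf.periodic w
    have h3 := (HasQExp.qParam.pow m).periodic w
    rw [h1]
    simp only [comp_apply, Pi.mul_apply, Pi.inv_apply, Pi.pow_apply] at h2 h3 ⊢
    rw [h2, h3]
  have h4 := (HasQExp.qParam.pow m).mul (HasQExp.of_qExpansion hper hdg hg)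
  have h5 : (fun τ : ℍ => Periodic.qParam 1 (τ : ℂ)) ^ m * g = f := by
    ext τ; simp [h]
  rw [h5] at h4
  rw [hf.unique h4 hd, PowerSeries.coeff_X_pow_mul', if_neg (by omega)]

theorem isBoundedAtImInfty_prod {ι : Type*} (s : Finset ι) {g : ι → ℍ → ℂ}
    (h : ∀ i ∈ s, IsBoundedAtImInfty (g i)) : IsBoundedAtImInfty (∏ i ∈ s, g i) := by
  classical
  induction s using Finset.induction_on with
  | empty => simpa using (HasQExp.one).isBoundedAtImInfty
  | insert i s hi ih =>
    rw [Finset.prod_insert hi]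
    exact (h i (Finset.mem_insert_self i s)).mul
      (ih fun j hj => h j (Finset.mem_insert_of_mem hj))

/-- A Sturm bound for weight four and level 42. -/
theorem IsModularOn.eq_zero {f : ℍ → ℂ} (hf : IsModularOn 42 4 f) {p : PowerSeries ℂ}
    (hp : HasQExp f p) (h : ∀ n < 33, p.coeff n = 0) : f = 0 := by
  classical
  set φ := hf.toModularForm
  have hφ : (φ : ℍ → ℂ) = f := rfl
  rw [← hφ, ← ModularForm.norm_eq_zero_iff 𝒮ℒ φ]
  apply ModularForm.sturm_bound_levelOne
  obtain ⟨g, hg, hfg⟩ := hp.eq_qParam_pow_mul h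
  set F := ModularForm.norm 𝒮ℒ φ
  have hF : HasQExp F (qExpansion 1 F) := fun τ => by
    simpa using ModularForm.hasSum_qExpansion (h := 1) F one_pos one_mem_strictPeriods_SL τ
  let := Fintype.ofFinite (𝒮ℒ ⧸ ((CongruenceSubgroup.Gamma0 42).map
    (Matrix.SpecialLinearGroup.mapGL ℝ)).subgroupOf 𝒮ℒ)
  set Q := SlashInvariantForm.quotientFunc (ℋ := 𝒮ℒ) φ
  have hQ (q) : IsBoundedAtImInfty (Q q) := by
    induction q using Quotient.inductionOn with
    | h r =>
      obtain ⟨γ, hγ⟩ := r⁻¹.2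
      have h1 : Q ⟦r⟧ = f ∣[(4 : ℤ)] γ := by
        have h2 : Q ⟦r⟧ = (φ : ℍ → ℂ) ∣[(4 : ℤ)] (r⁻¹ : 𝒮ℒ).1 := rfl
        rw [h2, ← hγ]
        rfl
      exact h1 ▸ hf.bounded γ
  set q₁ : 𝒮ℒ ⧸ ((CongruenceSubgroup.Gamma0 42).map
    (Matrix.SpecialLinearGroup.mapGL ℝ)).subgroupOf 𝒮ℒ := QuotientGroup.mk 1
  -- The identity coset contributes f itself, hence q³³; the other factors are bounded at infinity.
  have hprod : (F : ℍ → ℂ) = Q q₁ * ∏ q ∈ Finset.univ.erase q₁, Q q := by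
    rw [Finset.mul_prod_erase _ _ (Finset.mem_univ _)]
    convert! ModularForm.coe_norm 𝒮ℒ φ
  have hQ1 : Q q₁ = f := by
    have : Q q₁ = (φ : ℍ → ℂ) ∣[(4 : ℤ)] (1 : GL (Fin 2) ℝ)⁻¹ := rfl
    rw [this, inv_one, SlashAction.slash_one, hφ]
  have hord : (33 : ℕ∞) ≤ (qExpansion 1 F).order := by
    refine PowerSeries.nat_le_order _ 33 fun n hn => ?_
    refine hF.coeff_eq_zero F.holo' (hg.mul (isBoundedAtImInfty_prod (Finset.univ.erase q₁)
      fun q _ => hQ q)) (fun τ => ?_) hn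
    rw [hprod, hQ1, Pi.mul_apply, hfg, Pi.mul_apply, mul_assoc]
  refine lt_of_lt_of_le ?_ hord
  -- The norm has weight 4 · index ≤ 384, and 384/12 = 32 < 33.
  have hcard := (card_quotient_Gamma0 42).le.trans index_Gamma0_42_le
  have : (4 * (Nat.card (𝒮ℒ ⧸ ((CongruenceSubgroup.Gamma0 42).map
    (Matrix.SpecialLinearGroup.mapGL ℝ)).subgroupOf 𝒮ℒ) : ℤ)).toNat / 12 < 33 := by omega
  exact_mod_cast this

/-! ### Arithmetic of power series modulo q³³ -/

/-- The polynomial with the given list of coefficients, as a power series. -/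
noncomputable def ofList : List ℤ → PowerSeries ℤ
  | [] => 0
  | x :: xs => PowerSeries.C x + PowerSeries.X * ofList xs

theorem coeff_ofList (l : List ℤ) (n : ℕ) : (ofList l).coeff n = l.getD n 0 := by
  induction l generalizing n with
  | nil => simp [ofList]
  | cons x xs ih =>
    cases n with
    | zero => simp [ofList]
    | succ n =>
      rw [ofList, map_add, PowerSeries.coeff_succ_X_mul, ih, PowerSeries.coeff_C, if_neg n.succ_ne_zero]
      simp

/-- Sum of coefficient lists. -/
def addL : List ℤ → List ℤ → List ℤ
  | [], b => b
  | a, [] => a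
  | x :: xs, y :: ys => (x + y) :: addL xs ys

theorem ofList_addL (a b : List ℤ) : ofList (addL a b) = ofList a + ofList b := by
  fun_induction addL a b with
  | case1 => simp [ofList]
  | case2 => simp [ofList]
  | case3 x xs y ys ih => rw [ofList, ofList, ofList, ih, map_add]; ring

/-- Scalar multiple of a coefficient list. -/
def smulL (c : ℤ) (l : List ℤ) : List ℤ := l.map (c * ·)

theorem ofList_smulL (c : ℤ) (l : List ℤ) : ofList (smulL c l) = PowerSeries.C c * ofList l := by
  induction l with
  | nil => simp [smulL, ofList]
  | cons x xs ih =>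
    rw [smulL] at ih ⊢
    rw [List.map_cons, ofList, ofList, ih, map_mul]
    ring

/-- Product of coefficient lists. -/
def mulL : List ℤ → List ℤ → List ℤ
  | [], _ => []
  | x :: xs, b => if x = 0 then 0 :: mulL xs b else addL (smulL x b) (0 :: mulL xs b)

theorem ofList_mulL (a b : List ℤ) : ofList (mulL a b) = ofList a * ofList b := by
  induction a with
  | nil => simp [mulL, ofList]
  | cons x xs ih =>
    rw [mulL]
    split_ifs with h
    · rw [ofList, ofList, ih, h, map_zero]; ring
    · rw [ofList_addL, ofList_smulL, ofList, ofList, ih, map_zero]; ring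

theorem ofList_replicate_append (m : ℕ) (l : List ℤ) :
    ofList (List.replicate m 0 ++ l) = PowerSeries.X ^ m * ofList l := by
  induction m with
  | zero => simp
  | succ m ih => rw [List.replicate_succ, List.cons_append, ofList, ih, map_zero]; ring

/-- The coefficient list of `p(q ^ d)`. -/
def spreadL (d : ℕ) : List ℤ → List ℤ
  | [] => []
  | x :: xs => x :: (List.replicate (d - 1) 0 ++ spreadL d xs)

theorem ofList_spreadL (d : ℕ) (hd : d ≠ 0) (l : List ℤ) :
    ofList (spreadL d l) = (ofList l).expand d hd := by
  induction l with
  | nil => simp [spreadL, ofList]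
  | cons x xs ih =>
    rw [spreadL, ofList, ofList_replicate_append, ih, ofList, map_add, map_mul, PowerSeries.expand_C,
      PowerSeries.expand_X, ← mul_assoc, ← pow_succ', Nat.sub_add_cancel (Nat.pos_of_ne_zero hd)]

/-- The list `l` gives the first 33 coefficients of the power series `p`. -/
def IsTrunc (p : PowerSeries ℤ) (l : List ℤ) : Prop := PowerSeries.X ^ 33 ∣ p - ofList l

namespace IsTrunc

variable {p q : PowerSeries ℤ} {a b : List ℤ}

theorem of_coeff (h : ∀ n < 33, p.coeff n = a.getD n 0) : IsTrunc p a := by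
  rw [IsTrunc, PowerSeries.X_pow_dvd_iff]
  intro n hn
  rw [map_sub, h n hn, coeff_ofList, sub_self]

theorem coeff (h : IsTrunc p a) {n : ℕ} (hn : n < 33) : p.coeff n = a.getD n 0 := by
  rw [IsTrunc, PowerSeries.X_pow_dvd_iff] at h
  have := h n hn
  rwa [map_sub, coeff_ofList, sub_eq_zero] at this

theorem take (h : IsTrunc p a) : IsTrunc p (a.take 33) :=
  of_coeff fun n hn => by
    simp [h.coeff hn, List.getD_eq_getElem?_getD, hn]

theorem add (hp : IsTrunc p a) (hq : IsTrunc q b) : IsTrunc (p + q) (addL a b) := by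
  rw [IsTrunc, ofList_addL, add_sub_add_comm]
  exact dvd_add hp hq

theorem smul (hp : IsTrunc p a) (c : ℤ) : IsTrunc (PowerSeries.C c * p) (smulL c a) := by
  rw [IsTrunc, ofList_smulL, ← mul_sub]
  exact hp.mul_left _

theorem mul (hp : IsTrunc p a) (hq : IsTrunc q b) : IsTrunc (p * q) (mulL a b) := by
  rw [IsTrunc, ofList_mulL, show p * q - ofList a * ofList b =
    (p - ofList a) * q + ofList a * (q - ofList b) by ring]
  exact dvd_add (hp.mul_right _) (hq.mul_left _)

theorem X_pow_mul (hp : IsTrunc p a) (m : ℕ) :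
    IsTrunc (PowerSeries.X ^ m * p) (List.replicate m 0 ++ a) := by
  rw [IsTrunc, ofList_replicate_append, ← mul_sub]
  exact hp.mul_left _

theorem expand (hp : IsTrunc p a) (d : ℕ) (hd : d ≠ 0) : IsTrunc (p.expand d hd) (spreadL d a) := by
  rw [IsTrunc, ofList_spreadL d hd, ← map_sub]
  obtain ⟨r, hr⟩ := hp
  rw [hr, map_mul, map_pow, PowerSeries.expand_X, ← pow_mul]
  exact (pow_dvd_pow _ (Nat.le_mul_of_pos_left _ (Nat.pos_of_ne_zero hd))).mul_right _

theorem one : IsTrunc 1 [1] := by simp [IsTrunc, ofList]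

end IsTrunc

/-- The first coefficients of `∏ (1 - qⁿ)`. -/
def eulerL : List ℤ :=
  [1, -1, -1, 0, 0, 1, 0, 1, 0, 0, 0, 0, -1, 0, 0, -1, 0, 0, 0, 0, 0, 0, 1, 0, 0, 0, 1, 0, 0, 0,
    0, 0, 0]

/-- The first partition numbers, the coefficients of `∏ (1 - qⁿ)⁻¹`. -/
def eulerInvL : List ℤ :=
  [1, 1, 2, 3, 5, 7, 11, 15, 22, 30, 42, 56, 77, 101, 135, 176, 231, 297, 385, 490, 627, 792,
    1002, 1255, 1575, 1958, 2436, 3010, 3718, 4565, 5604, 6842, 8349]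

/-- The pentagonal numbers k(3k ± 1)/2 reach 35 at |k| = 5, so this range of k contains all those
below 33. -/
theorem coeff_eulerSeries {n : ℕ} (hn : n < 33) : eulerSeries.coeff n =
    ∑ k ∈ Finset.Icc (-5 : ℤ) 5, if pentagonal k = n then (-1) ^ k.natAbs else 0 := by
  by_cases h : n ∈ Set.range pentagonal
  · obtain ⟨k, rfl⟩ := h
    have hk := two_mul_natCast_pentagonal k
    have h1 : k ∈ Finset.Icc (-5 : ℤ) 5 := by
      rw [Finset.mem_Icc]
      constructor <;> nlinarith
    rw [eulerSeries, PowerSeries.coeff_pentagonalSeries_pentagonal,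
      Finset.sum_eq_single_of_mem k h1 fun b _ hb => if_neg fun h => hb (pentagonal_injective h),
      if_pos rfl]
    rw [← Int.negOnePow_abs, Int.abs_eq_natAbs]
    simp
  · rw [eulerSeries, PowerSeries.coeff_pentagonalSeries_eq_zero _ h, Finset.sum_eq_zero]
    exact fun k _ => if_neg fun hk => h ⟨k, hk⟩

theorem isTrunc_eulerSeries : IsTrunc eulerSeries eulerL := by
  refine IsTrunc.of_coeff fun n hn => ?_
  rw [coeff_eulerSeries hn]
  revert n
  decide +kernel

/-- The partition numbers are only verified: their product with the pentagonal list is 1 modulo q³³,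
and multiplying the error by the true inverse keeps it divisible by q³³. -/
theorem isTrunc_eulerSeriesInv : IsTrunc eulerSeriesInv eulerInvL := by
  have h1 : IsTrunc (eulerSeries * ofList eulerInvL) ((mulL eulerL eulerInvL).take 33) :=
    (isTrunc_eulerSeries.mul (by simp [IsTrunc])).take
  have h2 : (mulL eulerL eulerInvL).take 33 = 1 :: List.replicate 32 0 := by decide +kernel
  have h3 : ofList (1 :: List.replicate 32 0) = 1 := by
    rw [ofList, ← List.append_nil (List.replicate 32 0), ofList_replicate_append]
    simp [ofList]
  rw [h2, IsTrunc, h3] at h1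
  rw [IsTrunc, show eulerSeriesInv - ofList eulerInvL =
    -eulerSeriesInv * (eulerSeries * ofList eulerInvL - 1) by
      linear_combination ofList eulerInvL * eulerSeries_mul_inv]
  exact h1.mul_left _

/-- The first coefficients of the `n`-th power of a series. -/
def powL (l : List ℤ) : ℕ → List ℤ
  | 0 => [1]
  | n + 1 => (mulL l (powL l n)).take 33

theorem IsTrunc.pow {p : PowerSeries ℤ} {a : List ℤ} (h : IsTrunc p a) (n : ℕ) : IsTrunc (p ^ n) (powL a n) := by
  induction n with
  | zero => exact IsTrunc.one
  | succ n ih => rw [pow_succ']; exact (h.mul ih).take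

/-- The first coefficients of an integral power of `∏ (1 - qⁿ)`. -/
def eulerZPowL : ℤ → List ℤ
  | Int.ofNat n => powL eulerL n
  | Int.negSucc n => powL eulerInvL (n + 1)

theorem isTrunc_eulerSeriesZPow (e : ℤ) : IsTrunc (eulerSeriesZPow e) (eulerZPowL e) := by
  cases e with
  | ofNat n => exact isTrunc_eulerSeries.pow n
  | negSucc n => exact isTrunc_eulerSeriesInv.pow (n + 1)

/-! ### Expansions and modularity of the forms of level 42 -/

/-- The divisors of 42. -/
def etaLevels : Fin 8 → ℕ := ![1, 2, 3, 6, 7, 14, 21, 42]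

instance (i : Fin 8) : NeZero (etaLevels i) := ⟨by revert i; decide⟩

/-- The exponents of the twenty eta quotients. -/
def etaExps : Fin 20 → Fin 8 → ℤ :=
  ![![5, -1, 0, 0, 5, -1, 0, 0],
    ![2, 2, 0, 0, 2, 2, 0, 0],
    ![6, -2, 0, 0, -2, 6, 0, 0],
    ![-2, 6, 0, 0, 6, -2, 0, 0],
    ![2, 2, 2, 2, 0, 0, 0, 0],
    ![0, 1, 3, 0, 1, 0, 0, 3],
    ![1, 0, 0, 3, 0, 1, 3, 0],
    ![0, 0, 0, 0, 2, 2, 2, 2],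
    ![0, 0, 1, 1, 3, 3, 0, 0],
    ![0, 2, 0, 2, 2, 0, 2, 0],
    ![1, 1, 0, 0, 0, 0, 3, 3],
    ![3, 0, 0, 1, 0, 3, 1, 0],
    ![3, 3, 0, 0, 0, 0, 1, 1],
    ![0, 2, 0, 0, -2, 2, 6, 0],
    ![0, 6, 2, -2, 0, 0, 2, 0],
    ![-1, 5, 0, 0, 0, 0, 5, -1],
    ![0, 0, -2, 6, 0, 0, 6, -2],
    ![0, 0, -1, 3, 1, 1, 4, 0],
    ![0, 0, 2, 2, 0, 0, 2, 2],
    ![0, 0, 4, -2, -2, 4, 2, 2]]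

/-- The orders of vanishing of the twenty eta quotients at infinity. -/
def etaOrd : Fin 20 → ℕ := ![1, 2, 3, 1, 1, 6, 4, 7, 3, 3, 8, 3, 3, 6, 2, 3, 3, 5, 6, 7]

/-- The first coefficients of an eta quotient. -/
def etaQuotL (e : Fin 8 → ℤ) (m : ℕ) : List ℤ :=
  (List.replicate m 0 ++ (List.finRange 8).foldr
    (fun i l => (mulL ((spreadL (etaLevels i) (eulerZPowL (e i))).take 33) l).take 33) [1]).take 33

theorem isTrunc_etaQuotSeries (e : Fin 8 → ℤ) (m : ℕ) :
    IsTrunc (etaQuotSeries etaLevels e m) (etaQuotL e m) := by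
  refine (IsTrunc.X_pow_mul ?_ m).take
  have h (s : List (Fin 8)) :
      IsTrunc (s.map fun i => (eulerSeriesZPow (e i)).expand (etaLevels i) (NeZero.ne _)).prod
        (s.foldr (fun i l => (mulL ((spreadL (etaLevels i) (eulerZPowL (e i))).take 33) l).take 33)
          [1]) := by
    induction s with
    | nil => exact IsTrunc.one
    | cons i s ih =>
      rw [List.map_cons, List.prod_cons, List.foldr_cons]
      exact ((((isTrunc_eulerSeriesZPow (e i)).expand _ _).take).mul ih).take
  have h8 := h (List.finRange 8)
  rwa [← Fin.prod_univ_def] at h8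

/-- The first coefficients of `E₂`. -/
def eisL₂ : List ℤ :=
  [1, -24, -72, -96, -168, -144, -288, -192, -360, -312, -432, -288, -672, -336, -576, -576,
    -744, -432, -936, -480, -1008, -768, -864, -576, -1440, -744, -1008, -960, -1344, -720,
    -1728, -768, -1512]

/-- The first coefficients of `E₄`. -/
def eisL₄ : List ℤ :=
  [1, 240, 2160, 6720, 17520, 30240, 60480, 82560, 140400, 181680, 272160, 319680, 490560,
    527520, 743040, 846720, 1123440, 1179360, 1635120, 1646400, 2207520, 2311680, 2877120,
    2920320, 3931200, 3780240, 4747680, 4905600, 6026880, 5853600, 7620480, 7150080, 8987760]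

theorem isTrunc_eisSeries₂ : IsTrunc eisSeries₂ eisL₂ := by
  refine IsTrunc.of_coeff fun n hn => ?_
  rw [eisSeries₂, PowerSeries.coeff_mk]
  revert n
  decide +kernel

theorem isTrunc_eisSeries₄ : IsTrunc eisSeries₄ eisL₄ := by
  refine IsTrunc.of_coeff fun n hn => ?_
  rw [eisSeries₄, PowerSeries.coeff_mk]
  revert n
  decide +kernel

/-- The `q`-expansion of `r E₂(r z) - s E₂(s z)`. -/
noncomputable def eisDiffSeries (r s : ℕ) [NeZero r] [NeZero s] : PowerSeries ℤ :=
  PowerSeries.C (r : ℤ) * eisSeries₂.expand r (NeZero.ne r) +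
    PowerSeries.C (-s : ℤ) * eisSeries₂.expand s (NeZero.ne s)

/-- The `q`-expansion of a combination of the `E₄(δ z)` and of the twenty eta quotients. -/
noncomputable def combSeries (α : Fin 8 → ℤ) (β : Fin 20 → ℤ) : PowerSeries ℤ :=
  ∑ i, PowerSeries.C (α i) * eisSeries₄.expand (etaLevels i) (NeZero.ne _) +
    ∑ k, PowerSeries.C (β k) * etaQuotSeries etaLevels (etaExps k) (etaOrd k)

/-- The first coefficients of `(r E₂(r z) - s E₂(s z))²`. -/
def eisDiffSqL (r s : ℕ) : List ℤ :=
  (mulL (addL (smulL r ((spreadL r eisL₂).take 33)) (smulL (-s) ((spreadL s eisL₂).take 33)))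
    (addL (smulL r ((spreadL r eisL₂).take 33)) (smulL (-s) ((spreadL s eisL₂).take 33)))).take 33

/-- The first coefficients of `combSeries α β`. -/
def combL (α : Fin 8 → ℤ) (β : Fin 20 → ℤ) : List ℤ :=
  (addL ((List.finRange 8).foldr (fun i l => addL (smulL (α i)
      ((spreadL (etaLevels i) eisL₄).take 33)) l) [])
    ((List.finRange 20).foldr (fun k l => addL (smulL (β k)
      (etaQuotL (etaExps k) (etaOrd k))) l) [])).take 33

theorem isTrunc_eisDiffSeries_sq (r s : ℕ) [NeZero r] [NeZero s] :
    IsTrunc (eisDiffSeries r s * eisDiffSeries r s) (eisDiffSqL r s) := by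
  have h : IsTrunc (eisDiffSeries r s) _ :=
    ((isTrunc_eisSeries₂.expand r (NeZero.ne r)).take.smul r).add
      ((isTrunc_eisSeries₂.expand s (NeZero.ne s)).take.smul (-s))
  exact (h.mul h).take

theorem isTrunc_sum {n : ℕ} {p : Fin n → PowerSeries ℤ} {a : Fin n → List ℤ}
    (h : ∀ i, IsTrunc (p i) (a i)) (c : Fin n → ℤ) :
    IsTrunc (∑ i, PowerSeries.C (c i) * p i)
      ((List.finRange n).foldr (fun i l => addL (smulL (c i) (a i)) l) []) := by
  rw [Fin.sum_univ_def]
  induction List.finRange n with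
  | nil => simp [IsTrunc, ofList]
  | cons i s ih =>
    rw [List.map_cons, List.sum_cons, List.foldr_cons]
    exact ((h i).smul (c i)).add ih

theorem isTrunc_combSeries (α : Fin 8 → ℤ) (β : Fin 20 → ℤ) :
    IsTrunc (combSeries α β) (combL α β) :=
  ((isTrunc_sum (fun i => (isTrunc_eisSeries₄.expand _ (NeZero.ne (etaLevels i))).take) α).add
    (isTrunc_sum (fun k => isTrunc_etaQuotSeries (etaExps k) (etaOrd k)) β)).take

theorem etaExps_sum (k : Fin 20) :
    ∑ i, (etaLevels i : ℤ) * etaExps k i = 24 * etaOrd k := by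
  revert k; decide +kernel

theorem isEtaQuotOfLevel_etaExps (k : Fin 20) : IsEtaQuotOfLevel etaLevels (etaExps k) 42 where
  six_dvd := by norm_num
  dvd := by decide
  sum_eq := by revert k; decide +kernel
  sum_mul := by rw [etaExps_sum]; exact dvd_mul_right _ _
  sum_div_mul := by revert k; decide +kernel
  even_sum := by revert k; decide +kernel
  isSquare := by
    -- The integer square root serves as a witness, so that squareness is settled by evaluation.
    have h : ∀ k : Fin 20, ∏ i, etaLevels i ^ (etaExps k i).natAbs =
      Nat.sqrt (∏ i, etaLevels i ^ (etaExps k i).natAbs) *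
        Nat.sqrt (∏ i, etaLevels i ^ (etaExps k i).natAbs) := by decide +kernel
    exact ⟨_, h k⟩

theorem isModularOn_etaQuot (k : Fin 20) : IsModularOn 42 4 (etaQuot etaLevels (etaExps k)) := by
  refine (isEtaQuotOfLevel_etaExps k).isModularOn ?_ (by norm_num)
  rw [show Nat.divisors 42 = {1, 2, 3, 6, 7, 14, 21, 42} by decide +kernel]
  revert k
  decide +kernel

/-! ### The four identities in weight 4 -/

theorem map_C_int (c : ℤ) :
    (PowerSeries.C c).map (Int.castRingHom ℂ) = PowerSeries.C (c : ℂ) := PowerSeries.map_C _ _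

theorem hasQExp_eisDiff (r s : ℕ) [NeZero r] [NeZero s] :
    HasQExp (eisDiff r s) ((eisDiffSeries r s).map (Int.castRingHom ℂ)) := by
  have h := ((hasQExp_E2.scale r).smul r).sub ((hasQExp_E2.scale s).smul s)
  convert! h using 1
  rw [eisDiffSeries]
  rw [map_add, map_mul, map_mul, map_C_int, map_C_int, PowerSeries.map_expand,
    PowerSeries.map_expand, PowerSeries.smul_eq_C_mul, PowerSeries.smul_eq_C_mul, Int.cast_neg,
    map_neg, Int.cast_natCast, Int.cast_natCast]
  ring

/-- The coefficients of the expression of `M (r E₂(r z) - s E₂(s z))²` through `E₄(δ z)` and the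
eta quotients can be checked on finitely many terms. -/
theorem eisDiffSeries_sq_eq (r s : ℕ) [NeZero r] [NeZero s] (hr : r ∣ 42) (hs : s ∣ 42) (M : ℤ)
    (α : Fin 8 → ℤ) (β : Fin 20 → ℤ) (h : smulL M (eisDiffSqL r s) = combL α β) :
    PowerSeries.C M * (eisDiffSeries r s * eisDiffSeries r s) = combSeries α β := by
  set f : ℍ → ℂ := ((M : ℂ) • (eisDiff r s * eisDiff r s) -
    ((∑ i, (α i : ℂ) • fun z => ModularForm.E₄ (scaleH (etaLevels i) z)) +
      ∑ k, (β k : ℂ) • etaQuot etaLevels (etaExps k)))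
  have hlev : ∀ i, etaLevels i ∣ 42 := by decide
  have hf : IsModularOn 42 4 f :=
    ((isModularOn_eisDiff_sq r s hr hs).smul M).sub
      ((IsModularOn.sum _ fun i => (isModularOn_E₄_scale (etaLevels i) (hlev i)).smul _).add
        (IsModularOn.sum _ fun k => (isModularOn_etaQuot k).smul _))
  set P := PowerSeries.C M * (eisDiffSeries r s * eisDiffSeries r s) - combSeries α β
  have hP : HasQExp f (P.map (Int.castRingHom ℂ)) := by
    have h := (((hasQExp_eisDiff r s).mul (hasQExp_eisDiff r s)).smul M).sub
      ((HasQExp.sum (s := Finset.univ) fun i _ => (hasQExp_E₄.scale (etaLevels i)).smul (α i)).add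
        (HasQExp.sum (s := Finset.univ) fun k _ => (hasQExp_etaQuot (etaExps_sum k)).smul (β k)))
    convert! h using 1
    simp only [P, combSeries, map_sub, map_add, map_mul, map_sum, map_C_int,
      PowerSeries.map_expand, PowerSeries.smul_eq_C_mul]
  have h0 : ∀ n < 33, P.coeff n = 0 := fun n hn => by
    rw [map_sub, ((isTrunc_eisDiffSeries_sq r s).smul M).coeff hn, h,
      (isTrunc_combSeries α β).coeff hn, sub_self]
  have hz : f = 0 := hf.eq_zero hP fun n hn => by
    rw [PowerSeries.coeff_map, h0 n hn, map_zero]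
  have h1 : HasQExp f 0 := fun τ => by simp [hz]
  have h2 : P.map (Int.castRingHom ℂ) = 0 := hP.unique h1 hf.mdiff
  have h3 : P = 0 := PowerSeries.map_injective (Int.castRingHom ℂ) Int.cast_injective
    (by rw [h2, map_zero])
  exact sub_eq_zero.mp h3

/-- In all four identities 625 clears denominators. The coefficient of E₄(δz) is −21δ², plus 625δ²
when δ is r or s; as ∑ δ² = 2500 and rs = 42, the constant terms add up to 625(r − s)². The eta
coefficients are −625 · 48384 times those in the formula for the convolution sum. -/
theorem eisDiffSeries_sq_1_42 :
    PowerSeries.C 625 * (eisDiffSeries 1 42 * eisDiffSeries 1 42) = combSeries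
      ![604, -84, -189, -756, -1029, -4116, -9261, 1065456]
      ![864000, 615600, 0, 216000, 5040, -37044000, 133509600, -10337040, -4284000, 58665600,
    -410508000, 25603200, -15624000, 81648000, 6048000, -65016000, 0, 27216000, 680400, 4536000] :=
  eisDiffSeries_sq_eq 1 42 (by norm_num) (by norm_num) _ _ _ (by decide +kernel)

theorem eisDiffSeries_sq_2_21 :
    PowerSeries.C 625 * (eisDiffSeries 2 21 * eisDiffSeries 2 21) = combSeries
      ![-21, 2416, -189, -756, -1029, -4116, 266364, -37044]
      ![432000, 615600, 1080000, -432000, 5040, -49140000, 106293600, 21414960, -10332000, 58665600,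
    -286524000, 24595200, -16632000, 108864000, 3024000, -58968000, 0, -9072000, 680400, 13608000] :=
  eisDiffSeries_sq_eq 2 21 (by norm_num) (by norm_num) _ _ _ (by decide +kernel)

theorem eisDiffSeries_sq_3_14 :
    PowerSeries.C 625 * (eisDiffSeries 3 14 * eisDiffSeries 3 14) = combSeries
      ![-21, -84, 5436, -756, -1029, 118384, -9261, -37044]
      ![-864000, 75600, 0, 864000, 5040, 27972000, -126554400, 10830960, 4284000, -62294400,
    410508000, -26308800, 15624000, -81648000, -6048000, 65016000, 9720000, -27216000, 5540400,
    -4536000] :=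
  eisDiffSeries_sq_eq 3 14 (by norm_num) (by norm_num) _ _ _ (by decide +kernel)

theorem eisDiffSeries_sq_6_7 :
    PowerSeries.C 625 * (eisDiffSeries 6 7 * eisDiffSeries 6 7) = combSeries
      ![-21, -84, -189, 21744, 29596, -4116, -9261, -37044]
      ![-432000, 4395600, -1080000, -648000, 1085040, 40068000, -149018400, 31998960, 10332000,
    -19094400, 286524000, -41860800, 16632000, -108864000, -3024000, 58968000, -9720000, 9072000,
    44420400, -13608000] :=
  eisDiffSeries_sq_eq 6 7 (by norm_num) (by norm_num) _ _ _ (by decide +kernel)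

/-! ### From coefficients to convolution sums -/

theorem sigmaRat_natCast (k n : ℕ) : sigmaRat k (n : ℚ) = ArithmeticFunction.sigma k n := by
  simp [sigmaRat]

theorem sigmaRat_div (k n d : ℕ) [NeZero d] : sigmaRat k ((n : ℚ) / d) =
    if d ∣ n then ArithmeticFunction.sigma k (n / d) else 0 := by
  have hd : (d : ℚ) ≠ 0 := by exact_mod_cast NeZero.ne d
  split_ifs with h
  · rw [← Nat.cast_div h hd, sigmaRat_natCast]
  · rw [sigmaRat, if_neg]
    intro hden
    apply h
    have h1 : ((n : ℚ) / d) = (((n : ℚ) / d).num : ℚ) := (Rat.den_eq_one_iff _).mp hden |>.symm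
    rw [div_eq_iff hd] at h1
    have h2 : (n : ℤ) = ((n : ℚ) / d).num * d := by exact_mod_cast h1
    exact_mod_cast Dvd.intro_left _ h2.symm

theorem coeff_expand_eisSeries₂ (d : ℕ) [NeZero d] (n : ℕ) :
    (eisSeries₂.expand d (NeZero.ne d)).coeff n =
      (if n = 0 then 1 else 0) - 24 * (sigmaRat 1 ((n : ℚ) / d) : ℤ) := by
  rw [PowerSeries.coeff_expand, sigmaRat_div]
  have hd : d ≠ 0 := NeZero.ne d
  rcases eq_or_ne n 0 with rfl | hn
  · simp [eisSeries₂]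
  · split_ifs with h
    · have : n / d ≠ 0 := (Nat.div_pos (Nat.le_of_dvd (Nat.pos_of_ne_zero hn) h)
        (Nat.pos_of_ne_zero hd)).ne'
      rw [eisSeries₂, PowerSeries.coeff_mk, if_neg this]
      ring
    · simp

theorem coeff_expand_eisSeries₄ (d : ℕ) [NeZero d] {n : ℕ} (hn : n ≠ 0) :
    (eisSeries₄.expand d (NeZero.ne d)).coeff n = 240 * (sigmaRat 3 ((n : ℚ) / d) : ℤ) := by
  rw [PowerSeries.coeff_expand, sigmaRat_div]
  have hd : d ≠ 0 := NeZero.ne d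
  split_ifs with h
  · have : n / d ≠ 0 := (Nat.div_pos (Nat.le_of_dvd (Nat.pos_of_ne_zero hn) h)
      (Nat.pos_of_ne_zero hd)).ne'
    rw [eisSeries₄, PowerSeries.coeff_mk, if_neg this]
  · simp

/-- Ramanujan's identity at q^d involves 12(n/d); the factor d turns this into 12n, and 12 · 24 =
288. -/
theorem coeff_expand_sq (d : ℕ) [NeZero d] {n : ℕ} (hn : n ≠ 0) :
    d * (eisSeries₂.expand d (NeZero.ne d) * eisSeries₂.expand d (NeZero.ne d)).coeff n =
      240 * d * (sigmaRat 3 ((n : ℚ) / d) : ℤ) - 288 * n * (sigmaRat 1 ((n : ℚ) / d) : ℤ) := by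
  rw [← map_mul, eisSeries₂_sq, map_add, map_add, coeff_expand_eisSeries₄ d hn,
    PowerSeries.coeff_expand]
  have h2 := coeff_expand_eisSeries₂ d n
  rw [PowerSeries.coeff_expand, if_neg hn] at h2
  split_ifs at h2 ⊢ with h
  · rw [PowerSeries.coeff_mk, h2]
    obtain ⟨m, rfl⟩ := h
    rw [Nat.mul_div_cancel_left m (NeZero.pos d)]
    push_cast
    ring
  · linear_combination 12 * n * h2

/-- The convolution sum as a coefficient of a product of power series. -/
theorem sum_antidiagonal_sigmaRat (r s n : ℕ) [NeZero r] [NeZero s] :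
    ∑ p ∈ Finset.HasAntidiagonal.antidiagonal n, sigmaRat 1 ((p.1 : ℚ) / r) * sigmaRat 1 ((p.2 : ℚ) / s) =
      convSum r s n := by
  have hr := NeZero.pos r
  have hs := NeZero.pos s
  symm
  refine Finset.sum_of_injOn (fun p => (r * p.1, s * p.2)) ?_ ?_ ?_ ?_
  · rintro ⟨a, b⟩ - ⟨c, d⟩ - h
    simpa [hr.ne', hs.ne'] using h
  · rintro ⟨a, b⟩ h
    simp at h ⊢
    exact h.2
  -- A pair not of the form (rl, sm) contributes nothing, because `sigmaRat` vanishes at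
  -- non-integers.
  · rintro ⟨i, j⟩ h1 h2
    rw [sigmaRat_div, sigmaRat_div]
    by_cases hi : r ∣ i
    · by_cases hj : s ∣ j
      · exfalso
        obtain ⟨a, rfl⟩ := hi
        obtain ⟨b, rfl⟩ := hj
        rw [Finset.HasAntidiagonal.mem_antidiagonal] at h1
        simp only at h1
        refine h2 ⟨(a, b), ?_, rfl⟩
        have ha : a ≤ r * a := Nat.le_mul_of_pos_left _ hr
        have hb : b ≤ s * b := Nat.le_mul_of_pos_left _ hs
        simp only [Finset.coe_filter, Finset.mem_product, Finset.mem_range, Set.mem_ofPred_eq]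
        exact ⟨⟨by omega, by omega⟩, h1⟩
      · rw [if_neg hj, mul_zero]
    · rw [if_neg hi, zero_mul]
  · rintro ⟨a, b⟩ -
    rw [sigmaRat_div, sigmaRat_div, sigmaRat_natCast, sigmaRat_natCast]
    simp [hr, hs]

theorem coeff_expand_mul_expand (r s : ℕ) [NeZero r] [NeZero s] {n : ℕ} (hn : n ≠ 0) :
    (eisSeries₂.expand r (NeZero.ne r) * eisSeries₂.expand s (NeZero.ne s)).coeff n =
      576 * (convSum r s n : ℤ) - 24 * (sigmaRat 1 ((n : ℚ) / r) : ℤ) -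
        24 * (sigmaRat 1 ((n : ℚ) / s) : ℤ) := by
  set a : ℕ → PowerSeries ℤ := fun r => PowerSeries.mk fun n => (sigmaRat 1 ((n : ℚ) / r) : ℤ)
  have h (r : ℕ) [NeZero r] : eisSeries₂.expand r (NeZero.ne r) = 1 - 24 * a r := by
    ext n
    rw [coeff_expand_eisSeries₂, map_sub, PowerSeries.coeff_one,
      show (24 : PowerSeries ℤ) = PowerSeries.C 24 by simp, PowerSeries.coeff_C_mul,
      PowerSeries.coeff_mk]
  have h2 : (a r * a s).coeff n = convSum r s n := by
    rw [PowerSeries.coeff_mul, ← sum_antidiagonal_sigmaRat]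
    simp [a]
  rw [h r, h s, show (1 - 24 * a r) * (1 - 24 * a s) = 1 + PowerSeries.C 576 * (a r * a s) -
    PowerSeries.C 24 * a r - PowerSeries.C 24 * a s by simp; ring]
  simp only [map_add, map_sub, PowerSeries.coeff_C_mul, h2, PowerSeries.coeff_one, if_neg hn]
  simp [a]

theorem coeff_eisDiffSeries_sq (r s : ℕ) [NeZero r] [NeZero s] {n : ℕ} (hn : n ≠ 0) :
    (eisDiffSeries r s * eisDiffSeries r s).coeff n =
      r * (240 * r * (sigmaRat 3 ((n : ℚ) / r) : ℤ) - 288 * n * (sigmaRat 1 ((n : ℚ) / r) : ℤ)) +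
      s * (240 * s * (sigmaRat 3 ((n : ℚ) / s) : ℤ) - 288 * n * (sigmaRat 1 ((n : ℚ) / s) : ℤ)) -
      2 * r * s * (576 * (convSum r s n : ℤ) - 24 * (sigmaRat 1 ((n : ℚ) / r) : ℤ) -
        24 * (sigmaRat 1 ((n : ℚ) / s) : ℤ)) := by
  rw [← coeff_expand_sq r hn, ← coeff_expand_sq s hn, ← coeff_expand_mul_expand r s hn,
    eisDiffSeries]
  set A := eisSeries₂.expand r (NeZero.ne r)
  set B := eisSeries₂.expand s (NeZero.ne s)
  rw [show (PowerSeries.C (r : ℤ) * A + PowerSeries.C (-s : ℤ) * B) *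
    (PowerSeries.C (r : ℤ) * A + PowerSeries.C (-s : ℤ) * B) =
      PowerSeries.C (r * r : ℤ) * (A * A) + PowerSeries.C (s * s : ℤ) * (B * B) -
        PowerSeries.C (2 * r * s : ℤ) * (A * B) by simp only [map_mul, map_neg, map_ofNat]; ring]
  simp only [map_add, map_sub, PowerSeries.coeff_C_mul]
  ring

theorem etaC_eq (k : Fin 20) :
    (fun z : ℍ => etaC (k + 1) z) = etaQuot etaLevels (etaExps k) := by
  ext z
  rw [etaQuot, Fin.prod_univ_eight]
  fin_cases k <;>
  · simp [etaC, etaLevels, etaExps, zpow_neg, zpow_ofNat, div_eq_mul_inv]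
    try ring

theorem etaCoeff_eq (k : Fin 20) (n : ℕ) :
    etaCoeff (k + 1) n = ((etaQuotSeries etaLevels (etaExps k) (etaOrd k)).coeff n : ℤ) := by
  rw [etaCoeff, etaC_eq, (hasQExp_etaQuot (etaExps_sum k)).qExpansion_eq (mdiff_etaQuot _ _),
    PowerSeries.coeff_map, eq_intCast]

theorem etaOrd_ne_zero : ∀ k, etaOrd k ≠ 0 := by decide

theorem hasSum_etaC (k : Fin 20) (z : ℍ) : HasSum
    (fun n : ℕ => etaCoeff (k + 1) (n + 1) * Complex.exp (2 * Real.pi * Complex.I * z) ^ (n + 1))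
      (etaC (k + 1) z) := by
  have h := hasQExp_etaQuot (etaExps_sum k) z
  rw [← congrFun (etaC_eq k) z] at h
  have h1 := (hasSum_nat_add_iff' 1).mpr h
  -- Every order at infinity is at least 1, so the sum may start at q.
  have h0 : (etaQuotSeries etaLevels (etaExps k) (etaOrd k)).coeff 0 = 0 := by
    have hm : etaOrd k ≠ 0 := etaOrd_ne_zero k
    rw [etaQuotSeries, PowerSeries.coeff_X_pow_mul', if_neg (by omega)]
  rw [Finset.sum_range_one, PowerSeries.coeff_map, h0, map_zero, zero_mul, sub_zero] at h1
  convert! h1 using 2 with n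
  rw [etaCoeff_eq, PowerSeries.coeff_map, eq_intCast]
  simp [Periodic.qParam]

theorem coeff_combSeries (α : Fin 8 → ℤ) (β : Fin 20 → ℤ) {n : ℕ} (hn : n ≠ 0) :
    ((combSeries α β).coeff n : ℂ) = ∑ i, (α i : ℂ) * (240 * sigmaRat 3 ((n : ℚ) / etaLevels i)) +
      ∑ k : Fin 20, (β k : ℂ) * etaCoeff (k + 1) n := by
  simp only [combSeries, map_add, map_sum, PowerSeries.coeff_C_mul, Int.cast_add, Int.cast_sum,
    Int.cast_mul, etaCoeff_eq, coeff_expand_eisSeries₄ _ hn]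
  push_cast
  rfl

/-- The convolution sum in terms of the coefficients of a combination of forms. -/
theorem convSum_eq {r s : ℕ} [NeZero r] [NeZero s] {α : Fin 8 → ℤ} {β : Fin 20 → ℤ}
    (h : PowerSeries.C 625 * (eisDiffSeries r s * eisDiffSeries r s) = combSeries α β) {n : ℕ}
    (hn : n ≠ 0) :
    625 * (2 * r * s * 576 * (convSum r s n : ℂ)) =
      625 * (r * (240 * r * sigmaRat 3 ((n : ℚ) / r) - 288 * n * sigmaRat 1 ((n : ℚ) / r)) +
      s * (240 * s * sigmaRat 3 ((n : ℚ) / s) - 288 * n * sigmaRat 1 ((n : ℚ) / s)) +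
      2 * r * s * (24 * sigmaRat 1 ((n : ℚ) / r) + 24 * sigmaRat 1 ((n : ℚ) / s))) -
      (∑ i, (α i : ℂ) * (240 * sigmaRat 3 ((n : ℚ) / etaLevels i)) +
        ∑ k : Fin 20, (β k : ℂ) * etaCoeff (k + 1) n) := by
  rw [← coeff_combSeries α β hn, ← h, PowerSeries.coeff_C_mul, coeff_eisDiffSeries_sq r s hn]
  push_cast
  ring

end

theorem theorem7 :
    (∀ k ∈ Finset.Icc 1 20,
      (∀ n : ℕ, ∃ a : ℤ, etaCoeff k n = a) ∧
      ∀ z : ℍ, HasSum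
        (fun n : ℕ => etaCoeff k (n + 1) * Complex.exp (2 * Real.pi * Complex.I * z) ^ (n + 1))
        (etaC k z)) ∧
    ∀ n : ℕ, 0 < n →
      (convSum 1 42 n : ℂ) =
        1 / 6000 * sigmaRat 3 n + 1 / 1500 * sigmaRat 3 (n / 2) + 3 / 2000 * sigmaRat 3 (n / 3) +
        3 / 500 * sigmaRat 3 (n / 6) + 49 / 6000 * sigmaRat 3 (n / 7) +
        49 / 1500 * sigmaRat 3 (n / 14) + 147 / 2000 * sigmaRat 3 (n / 21) +
        147 / 500 * sigmaRat 3 (n / 42) + (1 / 24 - n / 168) * sigmaRat 1 n +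
        (1 / 24 - n / 4) * sigmaRat 1 (n / 42) - 1 / 35 * etaCoeff 1 n -
        57 / 2800 * etaCoeff 2 n - 1 / 140 * etaCoeff 4 n - 1 / 6000 * etaCoeff 5 n +
        49 / 40 * etaCoeff 6 n - 883 / 200 * etaCoeff 7 n + 2051 / 6000 * etaCoeff 8 n +
        17 / 120 * etaCoeff 9 n - 97 / 50 * etaCoeff 10 n + 543 / 40 * etaCoeff 11 n -
        127 / 150 * etaCoeff 12 n + 31 / 60 * etaCoeff 13 n - 27 / 10 * etaCoeff 14 n -
        1 / 5 * etaCoeff 15 n + 43 / 20 * etaCoeff 16 n - 9 / 10 * etaCoeff 18 n -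
        9 / 400 * etaCoeff 19 n - 3 / 20 * etaCoeff 20 n ∧
      (convSum 2 21 n : ℂ) =
        1 / 6000 * sigmaRat 3 n + 1 / 1500 * sigmaRat 3 (n / 2) + 3 / 2000 * sigmaRat 3 (n / 3) +
        3 / 500 * sigmaRat 3 (n / 6) + 49 / 6000 * sigmaRat 3 (n / 7) +
        49 / 1500 * sigmaRat 3 (n / 14) + 147 / 2000 * sigmaRat 3 (n / 21) +
        147 / 500 * sigmaRat 3 (n / 42) + (1 / 24 - n / 84) * sigmaRat 1 (n / 2) +
        (1 / 24 - n / 8) * sigmaRat 1 (n / 21) - 1 / 70 * etaCoeff 1 n -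
        57 / 2800 * etaCoeff 2 n - 1 / 28 * etaCoeff 3 n + 1 / 70 * etaCoeff 4 n -
        1 / 6000 * etaCoeff 5 n + 13 / 8 * etaCoeff 6 n - 703 / 200 * etaCoeff 7 n -
        4249 / 6000 * etaCoeff 8 n + 41 / 120 * etaCoeff 9 n - 97 / 50 * etaCoeff 10 n +
        379 / 40 * etaCoeff 11 n - 61 / 75 * etaCoeff 12 n + 11 / 20 * etaCoeff 13 n -
        18 / 5 * etaCoeff 14 n - 1 / 10 * etaCoeff 15 n + 39 / 20 * etaCoeff 16 n +
        3 / 10 * etaCoeff 18 n - 9 / 400 * etaCoeff 19 n - 9 / 20 * etaCoeff 20 n ∧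
      (convSum 3 14 n : ℂ) =
        1 / 6000 * sigmaRat 3 n + 1 / 1500 * sigmaRat 3 (n / 2) + 3 / 2000 * sigmaRat 3 (n / 3) +
        3 / 500 * sigmaRat 3 (n / 6) + 49 / 6000 * sigmaRat 3 (n / 7) +
        49 / 1500 * sigmaRat 3 (n / 14) + 147 / 2000 * sigmaRat 3 (n / 21) +
        147 / 500 * sigmaRat 3 (n / 42) + (1 / 24 - n / 56) * sigmaRat 1 (n / 3) +
        (1 / 24 - n / 12) * sigmaRat 1 (n / 14) + 1 / 35 * etaCoeff 1 n - 1 / 400 * etaCoeff 2 n -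
        1 / 35 * etaCoeff 4 n - 1 / 6000 * etaCoeff 5 n - 37 / 40 * etaCoeff 6 n +
        837 / 200 * etaCoeff 7 n - 2149 / 6000 * etaCoeff 8 n - 17 / 120 * etaCoeff 9 n +
        103 / 50 * etaCoeff 10 n - 543 / 40 * etaCoeff 11 n + 87 / 100 * etaCoeff 12 n -
        31 / 60 * etaCoeff 13 n + 27 / 10 * etaCoeff 14 n + 1 / 5 * etaCoeff 15 n -
        43 / 20 * etaCoeff 16 n - 9 / 28 * etaCoeff 17 n + 9 / 10 * etaCoeff 18 n -
        513 / 2800 * etaCoeff 19 n + 3 / 20 * etaCoeff 20 n ∧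
      (convSum 6 7 n : ℂ) =
        1 / 6000 * sigmaRat 3 n + 1 / 1500 * sigmaRat 3 (n / 2) + 3 / 2000 * sigmaRat 3 (n / 3) +
        3 / 500 * sigmaRat 3 (n / 6) + 49 / 6000 * sigmaRat 3 (n / 7) +
        49 / 1500 * sigmaRat 3 (n / 14) + 147 / 2000 * sigmaRat 3 (n / 21) +
        147 / 500 * sigmaRat 3 (n / 42) + (1 / 24 - n / 28) * sigmaRat 1 (n / 6) +
        (1 / 24 - n / 24) * sigmaRat 1 (n / 7) + 1 / 70 * etaCoeff 1 n -
        407 / 2800 * etaCoeff 2 n + 1 / 28 * etaCoeff 3 n + 3 / 140 * etaCoeff 4 n -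
        1507 / 42000 * etaCoeff 5 n - 53 / 40 * etaCoeff 6 n + 6899 / 1400 * etaCoeff 7 n -
        6349 / 6000 * etaCoeff 8 n - 41 / 120 * etaCoeff 9 n + 221 / 350 * etaCoeff 10 n -
        379 / 40 * etaCoeff 11 n + 969 / 700 * etaCoeff 12 n - 11 / 20 * etaCoeff 13 n +
        18 / 5 * etaCoeff 14 n + 1 / 10 * etaCoeff 15 n - 39 / 20 * etaCoeff 16 n +
        9 / 28 * etaCoeff 17 n - 3 / 10 * etaCoeff 18 n - 4113 / 2800 * etaCoeff 19 n +
        9 / 20 * etaCoeff 20 n := by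
  refine ⟨fun k hk => ?_, fun n hn => ?_⟩
  · obtain ⟨j, rfl⟩ : ∃ j : Fin 20, k = j + 1 := by
      rw [Finset.mem_Icc] at hk
      exact ⟨⟨k - 1, by omega⟩, by simp; omega⟩
    exact ⟨fun n => ⟨_, etaCoeff_eq j n⟩, hasSum_etaC j⟩
  · have hn0 : n ≠ 0 := hn.ne'
    have h1 := convSum_eq eisDiffSeries_sq_1_42 hn0
    have h2 := convSum_eq eisDiffSeries_sq_2_21 hn0
    have h3 := convSum_eq eisDiffSeries_sq_3_14 hn0
    have h4 := convSum_eq eisDiffSeries_sq_6_7 hn0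
    simp [Fin.sum_univ_succ, etaLevels] at h1 h2 h3 h4
    -- 48384 = 2 · 42 · 576 is the common value of 2rs · 576.
    refine ⟨?_, ?_, ?_, ?_⟩
    · linear_combination (1 / (625 * 48384)) * h1
    · linear_combination (1 / (625 * 48384)) * h2
    · linear_combination (1 / (625 * 48384)) * h3
    · linear_combination (1 / (625 * 48384)) * h4
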